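/- Let $N>2$ be an integer, $a>-2$ and $s>0$ real numbers. For $\delta,\mu>0$ consider the system $$(SN)\qquad -\Delta u=|x|^a u^s v^\delta,\qquad -\Delta v=|x|^a u^\mu v^s\qquad\text{in }\mathbb R^N .$$ A ground state of $(SN)$ is a pair of radial functions $u(x)=U(|x|)$, $v(x)=V(|x|)$ with $U,V\in C^2((0,\infty))\cap C([0,\infty))$, $U,V>0$ on $(0,\infty)$, satisfying $(SN)$ in $\mathbb R^N\setminus\{0\}$. Let $\mathcal C_s$ be the curve in the quadrant $\delta,\mu>0$ defined by $$\frac{N+a}{\mu+1}+\frac{N+a}{\delta+1}=N-2+\frac{(N-2)s}{2}\min\Bigl(\frac1{\mu+1},\frac1{\delta+1}\Bigr).$$ Then $\mathcal C_s$ is located under the hyperbola $\frac{N+a}{\delta+1}+\frac{N+a}{\mu+1}=N-2$, that is, $\frac{N+a}{\delta+1}+\frac{N+a}{\mu+1}>N-2$ at every point $(\delta,\mu)$ of $\mathcal C_s$. Moreover, if $\delta,\mu>0$, $\delta\mu-(1-s)^2>0$, and $(\delta,\mu)$ is above $\mathcal C_s$, that is, $$\frac{N+a}{\mu+1}+\frac{N+a}{\delta+1}<N-2+\frac{(N-2)s}{2}\min\Bigl(\frac1{\mu+1},\frac1{\delta+1}\Bigr),$$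 then $(SN)$ admits a ground state. -/

import Mathlib

/-- The radial function `x ↦ U |x|` on `ℝ^N` with profile `U`. -/
noncomputable def radialLift (N : ℕ) (U : ℝ → ℝ) : EuclideanSpace ℝ (Fin N) → ℝ :=
  fun x => U ‖x‖

/-- Regularity at `0` of a globally defined radial profile: of class `C²` on `(0, ∞)` and
continuous on `[0, ∞)`. -/
def RegularProfile (U : ℝ → ℝ) : Prop :=
  ContDiffOn ℝ 2 U (Set.Ioi 0) ∧ ContinuousOn U (Set.Ici 0)

/-- `(U, V)` is (the pair of profiles of) a radial ground state of the system
`-Δu = |x|^a u^s v^δ`, `-Δv = |x|^a u^μ v^s` in `ℝ^N`: both profiles are positive on `(0, ∞)`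
and regular at `0`, and the radial functions `u(x) = U |x|`, `v(x) = V |x|` satisfy the system
pointwise on `ℝ^N ∖ {0}` (for `a < 0` the weight `|x|^a` is singular at the origin).
`Laplacian.laplacian` is the usual Laplace operator on `ℝ^N`. -/
structure IsGroundState (N : ℕ) (a s δ μ : ℝ) (U V : ℝ → ℝ) : Prop where
  regular_fst : RegularProfile U
  regular_snd : RegularProfile V
  pos_fst : ∀ r : ℝ, 0 < r → 0 < U r
  pos_snd : ∀ r : ℝ, 0 < r → 0 < V r
  eq_fst : ∀ x : EuclideanSpace ℝ (Fin N), x ≠ 0 →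
    -(Laplacian.laplacian (radialLift N U) x) =
      ‖x‖ ^ a * radialLift N U x ^ s * radialLift N V x ^ δ
  eq_snd : ∀ x : EuclideanSpace ℝ (Fin N), x ≠ 0 →
    -(Laplacian.laplacian (radialLift N V) x) =
      ‖x‖ ^ a * radialLift N U x ^ μ * radialLift N V x ^ s

/-- The left-hand side of the equations of the two curves: `(N+a)/(μ+1) + (N+a)/(δ+1)`. -/
noncomputable def curveLHS (N : ℕ) (a δ μ : ℝ) : ℝ :=
  ((N : ℝ) + a) / (μ + 1) + ((N : ℝ) + a) / (δ + 1)

/-- The right-hand side of the equation of `C_s`: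
`N - 2 + ((N-2)s/2) min (1/(μ+1), 1/(δ+1))`. -/
noncomputable def curveRHS (N : ℕ) (s δ μ : ℝ) : ℝ :=
  (N : ℝ) - 2 + ((N : ℝ) - 2) * s / 2 * min (1 / (μ + 1)) (1 / (δ + 1))

/-- `(δ, μ)` lies on the curve `C_s`. -/
def OnCurve (N : ℕ) (a s δ μ : ℝ) : Prop := curveLHS N a δ μ = curveRHS N s δ μ

/-- `(δ, μ)` lies (strictly) above the curve `C_s`, on the side of large `δ` and `μ`. -/
def AboveCurve (N : ℕ) (a s δ μ : ℝ) : Prop := curveLHS N a δ μ < curveRHS N s δ μ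

/-- `(δ, μ)` lies (strictly) under the hyperbola `(N+a)/(δ+1) + (N+a)/(μ+1) = N - 2`. -/
def UnderHyperbola (N : ℕ) (a δ μ : ℝ) : Prop := (N : ℝ) - 2 < curveLHS N a δ μ

/-!
For a radial pair put `b = a + 2`, `ν = (N - 2) / b` and `x = r ^ b`. Up to constant factors the system
becomes `(x^{ν+1} φ')' = -P x^ν φ^s ψ^δ`, `(x^{ν+1} ψ')' = -Q x^ν φ^μ ψ^s`, without weight. Since
`δ μ ≠ (1 - s)^2`, amplitudes of `u` and `v` absorb any `P, Q > 0` (`exists_amplitudes`), so it suffices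
to find a solution with `φ(0) = ψ(0) = 1` that is positive on the half-line for some
`(P, Q) = (1 - t, t)`, `0 < t < 1`.

Such a `t` is found by shooting (`exists_staysPositive`). Suppose that none stays positive.
The parameters for which `φ` vanishes strictly before `ψ`, and those for which `ψ` vanishes strictly
before `φ`, form disjoint open subsets of `[0, 1]`. The first contains `0` and the second contains
`1`: there one component is constant and the other one solves a scalar equation. By connectedness,
both components vanish at the same point for some `t`, and this has to be excluded. If `s` is critical
or supercritical, the scalar Pohozaev energy (`IsPosSol.slope_le_of_supercritical`) shows instead that
every solution with `0 < t < 1` stays positive; if `s` is subcritical, it shows that the scalar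
solutions at `t = 0` and `t = 1` do vanish (`IsPosSol.not_global_scalar`).

Simultaneous vanishing is excluded above the curve by `IsPosSol.not_large_slopes`. With
`X = -x φ'/φ`, `Y = -x ψ'/ψ`, `S = x P φ^{s-1} ψ^δ`, `V = x Q φ^μ ψ^{s-1}`, consider
`x^ν φ ψ (X Y + S/(δ+1) + V/(μ+1) - (ν+1) Y/(μ+1) - (ν+1) X/(δ+1) + c (X² + Y² - T² + ν T))`,
where `T = ν / (1 - k x^ν)` is the slope of a harmonic function dominating `X` and `Y`, and `c` is
`s/2` times the minimum of `1/(μ+1)` and `1/(δ+1)`. The terms with `c` exploit the loss caused by the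
factors `u^s`, `v^s`; together with `cubic_slope_inequality` they make the energy decreasing
when `(δ, μ)` is above the curve. The energy tends to `0` at the origin but is positive where both
slopes are large.

Solutions up to the first zero come from the system with both unknowns clipped to `[η, 1]`, whose
nonlinearity is bounded and Lipschitz, so that a fixed point argument and uniqueness are available
although `u^s` need not be Lipschitz at `0`.
-/

open Set Filter Topology MeasureTheory
open scoped NNReal BoundedContinuousFunction

/-! ### Integrated radial equation: existence, uniqueness and dependence on the nonlinearity -/

section RadialEquation

variable {E : Type*} [NormedAddCommGroup E] [NormedSpace ℝ E]

/-- The weighted mean `∫₀¹ z^ν g(x z) dz`; for `x > 0` it equals `x^{-(ν+1)} ∫₀ˣ w^ν g(w) dw`. -/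
noncomputable def radialMean (ν : ℝ) (g : ℝ → E) (x : ℝ) : E :=
  ∫ z in (0 : ℝ)..1, z ^ ν • g (x * z)

/-- `y` solves `(x^{ν+1} y')' = -x^ν F(y)` on `[0, ρ]` with `y(0) = y₀` and a bounded derivative
at `0`, in integrated form. -/
def SolvesRadial (ν : ℝ) (F : E → E) (y₀ : E) (ρ : ℝ) (y : ℝ → E) : Prop :=
  ∀ x ∈ Icc 0 ρ, y x = y₀ - ∫ u in (0 : ℝ)..x, radialMean ν (fun v => F (y v)) u

lemma continuous_rpow_smul_comp {ν : ℝ} (hν : 0 < ν) {g : ℝ → E} (hg : Continuous g) (x : ℝ) :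
    Continuous fun z : ℝ => z ^ ν • g (x * z) :=
  (Real.continuous_rpow_const hν.le).smul (hg.comp (continuous_const.mul continuous_id))

lemma continuous_radialMean {ν : ℝ} (hν : 0 < ν) {g : ℝ → E} (hg : Continuous g) :
    Continuous (radialMean ν g) := by
  unfold radialMean
  apply intervalIntegral.continuous_parametric_intervalIntegral_of_continuous'
  have h1 : Continuous fun p : ℝ × ℝ => p.2 ^ ν :=
    (Real.continuous_rpow_const hν.le).comp continuous_snd
  exact h1.smul (hg.comp (continuous_fst.mul continuous_snd))

lemma norm_radialMean_le {ν : ℝ} (hν : 0 < ν) {g : ℝ → E} {x B : ℝ}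
    (h : ∀ z ∈ Icc (0 : ℝ) 1, ‖g (x * z)‖ ≤ B) : ‖radialMean ν g x‖ ≤ B := by
  have := intervalIntegral.norm_integral_le_of_norm_le_const (a := (0:ℝ)) (b := 1) (C := B)
    (f := fun z : ℝ => z ^ ν • g (x * z)) (by
      intro z hz
      rw [uIoc_of_le zero_le_one] at hz
      have hB := h z ⟨hz.1.le, hz.2⟩
      rw [norm_smul, Real.norm_of_nonneg (Real.rpow_nonneg hz.1.le _)]
      calc z ^ ν * ‖g (x * z)‖ ≤ 1 * ‖g (x * z)‖ := by
            gcongr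
            exact Real.rpow_le_one hz.1.le hz.2 hν.le
        _ ≤ B := by simpa using hB)
  simpa [radialMean] using this

lemma radialMean_sub {ν : ℝ} (hν : 0 < ν) {g h : ℝ → E} (hg : Continuous g) (hh : Continuous h)
    (x : ℝ) : radialMean ν g x - radialMean ν h x = radialMean ν (fun v => g v - h v) x := by
  unfold radialMean
  rw [← intervalIntegral.integral_sub
    ((continuous_rpow_smul_comp hν hg x).intervalIntegrable _ _)
    ((continuous_rpow_smul_comp hν hh x).intervalIntegrable _ _)]
  simp only [smul_sub]

lemma norm_integral_le_of_exp_bound {h : ℝ → E} {l A ε x : ℝ} (hl : 0 < l) (hA : 0 ≤ A)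
    (hx : 0 ≤ x) (hb : ∀ u ∈ Icc 0 x, ‖h u‖ ≤ ε + A * Real.exp (l * u)) :
    ‖∫ u in (0 : ℝ)..x, h u‖ ≤ ε * x + A / l * Real.exp (l * x) := by
  have hc : Continuous fun u : ℝ => ε + A * Real.exp (l * u) := by fun_prop
  have h1 : ‖∫ u in (0 : ℝ)..x, h u‖ ≤ ∫ u in (0 : ℝ)..x, (ε + A * Real.exp (l * u)) :=
    intervalIntegral.norm_integral_le_of_norm_le hx
      (Filter.Eventually.of_forall fun u hu => hb u ⟨hu.1.le, hu.2⟩) (hc.intervalIntegrable _ _)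
  have h2 : ∫ u in (0 : ℝ)..x, (ε + A * Real.exp (l * u))
      = (ε * x + A / l * Real.exp (l * x)) - (ε * 0 + A / l * Real.exp (l * 0)) := by
    apply intervalIntegral.integral_eq_sub_of_hasDerivAt
      (f := fun u => ε * u + A / l * Real.exp (l * u))
    · intro u _
      have e : HasDerivAt (fun u : ℝ => l * u) l u := by
        simpa using (hasDerivAt_id u).const_mul l
      have := ((hasDerivAt_id u).const_mul ε).add (e.exp.const_mul (A / l))
      refine HasDerivAt.congr_deriv this ?_
      field_simp
    · exact hc.intervalIntegrable _ _
  rw [h2] at h1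
  have h3 : 0 ≤ A / l := div_nonneg hA hl.le
  simp at h1
  linarith

/-- Dependence of the solutions on the nonlinearity; for `ε = 0` this is uniqueness. -/
lemma SolvesRadial.norm_sub_le {ν : ℝ} (hν : 0 < ν) {F₁ F₂ : E → E} {C : ℝ≥0}
    (hF₁ : LipschitzWith C F₁) (hF₂ : Continuous F₂) {y₀ : E} {ρ ε : ℝ} (hρ : 0 ≤ ρ)
    {y₁ y₂ : ℝ → E} (hy₁ : Continuous y₁) (hy₂ : Continuous y₂)
    (h₁ : SolvesRadial ν F₁ y₀ ρ y₁) (h₂ : SolvesRadial ν F₂ y₀ ρ y₂)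
    (hε : ∀ x ∈ Icc 0 ρ, ‖F₁ (y₂ x) - F₂ (y₂ x)‖ ≤ ε) :
    ∀ x ∈ Icc 0 ρ, ‖y₁ x - y₂ x‖ ≤ 2 * ε * ρ * Real.exp ((2 * C + 1) * ρ) := by
  set l : ℝ := 2 * C + 1 with hl
  have hC : (0 : ℝ) ≤ C := C.2
  have hl0 : 0 < l := by positivity
  have hε0 : 0 ≤ ε := (norm_nonneg _).trans (hε 0 ⟨le_rfl, hρ⟩)
  obtain ⟨x₀, hx₀, hmax⟩ := (isCompact_Icc (a := (0:ℝ)) (b := ρ)).exists_isMaxOn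
    ⟨0, le_rfl, hρ⟩ (f := fun x => Real.exp (-(l * x)) * ‖y₁ x - y₂ x‖)
    (Continuous.continuousOn (by fun_prop))
  set D : ℝ := Real.exp (-(l * x₀)) * ‖y₁ x₀ - y₂ x₀‖ with hD
  have hD0 : 0 ≤ D := by positivity
  have hbound : ∀ x ∈ Icc 0 ρ, ‖y₁ x - y₂ x‖ ≤ D * Real.exp (l * x) := by
    intro x hx
    have := hmax hx
    simp only [mem_ofPred_eq] at this
    rw [Real.exp_neg, inv_mul_le_iff₀ (Real.exp_pos _)] at this
    linarith [this]
  have hcF₁ : Continuous fun v => F₁ (y₁ v) := hF₁.continuous.comp hy₁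
  have hcF₂ : Continuous fun v => F₂ (y₂ v) := hF₂.comp hy₂
  have hkey : ‖y₁ x₀ - y₂ x₀‖ ≤ ε * x₀ + C * D / l * Real.exp (l * x₀) := by
    have e : y₁ x₀ - y₂ x₀ = -∫ u in (0 : ℝ)..x₀,
        radialMean ν (fun v => F₁ (y₁ v) - F₂ (y₂ v)) u := by
      rw [h₁ x₀ hx₀, h₂ x₀ hx₀]
      have : ∀ u, radialMean ν (fun v => F₁ (y₁ v) - F₂ (y₂ v)) u =
          radialMean ν (fun v => F₁ (y₁ v)) u - radialMean ν (fun v => F₂ (y₂ v)) u :=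
        fun u => (radialMean_sub hν hcF₁ hcF₂ u).symm
      simp only [this]
      rw [intervalIntegral.integral_sub
        ((continuous_radialMean hν hcF₁).intervalIntegrable _ _)
        ((continuous_radialMean hν hcF₂).intervalIntegrable _ _)]
      abel
    rw [e, norm_neg]
    apply norm_integral_le_of_exp_bound hl0 (by positivity) hx₀.1
    intro u hu
    apply norm_radialMean_le hν
    intro z hz
    have huz0 : 0 ≤ u * z := mul_nonneg hu.1 hz.1
    have huz : u * z ≤ u := mul_le_of_le_one_right hu.1 hz.2
    have hmem : u * z ∈ Icc 0 ρ := ⟨huz0, huz.trans (hu.2.trans hx₀.2)⟩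
    calc ‖F₁ (y₁ (u * z)) - F₂ (y₂ (u * z))‖
        ≤ ‖F₁ (y₂ (u * z)) - F₂ (y₂ (u * z))‖ + ‖F₁ (y₁ (u * z)) - F₁ (y₂ (u * z))‖ := by
          rw [add_comm]
          exact norm_sub_le_norm_sub_add_norm_sub _ _ _
      _ ≤ ε + C * (D * Real.exp (l * (u * z))) := by
          gcongr
          · exact hε _ hmem
          · exact (hF₁.norm_sub_le _ _).trans (by gcongr; exact hbound _ hmem)
      _ ≤ ε + C * D * Real.exp (l * u) := by
          rw [← mul_assoc]
          gcongr
  have hDle : D ≤ 2 * ε * ρ := by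
    have h1 : D ≤ Real.exp (-(l * x₀)) * (ε * x₀ + C * D / l * Real.exp (l * x₀)) := by
      rw [hD]; gcongr
    have h2 : Real.exp (-(l * x₀)) * (ε * x₀ + C * D / l * Real.exp (l * x₀))
        = Real.exp (-(l * x₀)) * (ε * x₀) + C * D / l := by
      have : Real.exp (-(l * x₀)) * Real.exp (l * x₀) = 1 := by
        rw [← Real.exp_add]; simp
      linear_combination (C * D / l) * this
    have h3 : Real.exp (-(l * x₀)) * (ε * x₀) ≤ 1 * (ε * ρ) := by
      have := hx₀.1
      gcongr
      · rw [Real.exp_le_one_iff]; nlinarith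
      · exact hx₀.2
    have h4 : C * D / l ≤ D / 2 := by
      rw [div_le_div_iff₀ hl0 two_pos]
      rw [hl]; nlinarith
    linarith
  intro x hx
  calc ‖y₁ x - y₂ x‖ ≤ D * Real.exp (l * x) := hbound x hx
    _ ≤ 2 * ε * ρ * Real.exp (l * ρ) := by
      gcongr
      exact hx.2

/-- Global solvability for a bounded Lipschitz nonlinearity. -/
lemma exists_solvesRadial [CompleteSpace E] {ν : ℝ} (hν : 0 < ν) {F : E → E} {C : ℝ≥0}
    (hF : LipschitzWith C F) {B : ℝ} (hB : ∀ e, ‖F e‖ ≤ B) (y₀ : E) :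
    ∃ y : ℝ → E, Continuous y ∧ ∀ ρ, SolvesRadial ν F y₀ ρ y := by
  set l : ℝ := 2 * C + 1 with hl
  have hC : (0 : ℝ) ≤ C := C.2
  have hl0 : 0 < l := by positivity
  have hl1 : 1 ≤ l := by rw [hl]; linarith
  have hB0 : 0 ≤ B := (norm_nonneg _).trans (hB y₀)
  -- the unknown is `w = e^{-l x} (y - y₀)`: the exponential weight turns the integral operator
  -- into a contraction on the whole half-line
  let Y : (ℝ →ᵇ E) → ℝ → E := fun w v => y₀ + Real.exp (l * max v 0) • w v
  have hY : ∀ w, Continuous (Y w) := fun w => by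
    have := w.continuous
    fun_prop
  have hFY : ∀ w, Continuous fun v => F (Y w v) := fun w => hF.continuous.comp (hY w)
  let I : (ℝ →ᵇ E) → ℝ → E := fun w x =>
    ∫ u in (0 : ℝ)..(max x 0), radialMean ν (fun v => F (Y w v)) u
  have hI : ∀ w, Continuous (I w) := fun w => by
    have h1 : Continuous fun x : ℝ =>
        ∫ u in (0 : ℝ)..x, radialMean ν (fun v => F (Y w v)) u :=
      intervalIntegral.continuous_primitive
        (fun a b => (continuous_radialMean hν (hFY w)).intervalIntegrable a b) 0
    exact h1.comp (continuous_id.max continuous_const)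
  have hIb : ∀ w x, ‖Real.exp (-(l * max x 0)) • -(I w x)‖ ≤ B := by
    intro w x
    have hx : 0 ≤ max x 0 := le_max_right _ _
    have h1 : ‖I w x‖ ≤ B * |max x 0 - 0| :=
      intervalIntegral.norm_integral_le_of_norm_le_const fun u _ =>
        norm_radialMean_le hν fun z _ => hB _
    rw [sub_zero, abs_of_nonneg hx] at h1
    rw [norm_smul, norm_neg, Real.norm_of_nonneg (Real.exp_pos _).le, Real.exp_neg,
      inv_mul_le_iff₀ (Real.exp_pos _)]
    have h2 : max x 0 ≤ Real.exp (l * max x 0) := by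
      have := Real.add_one_le_exp (l * max x 0)
      nlinarith
    calc ‖I w x‖ ≤ B * max x 0 := h1
      _ ≤ B * Real.exp (l * max x 0) := by gcongr
      _ = _ := mul_comm _ _
  let T : (ℝ →ᵇ E) → (ℝ →ᵇ E) := fun w =>
    BoundedContinuousFunction.ofNormedAddCommGroup
      (fun x => Real.exp (-(l * max x 0)) • -(I w x))
      (by have := hI w; fun_prop) B (hIb w)
  have hTa : ∀ w x, T w x = Real.exp (-(l * max x 0)) • -(I w x) := fun _ _ => rfl
  have hT : ContractingWith (1 / 2) T := by
    refine ⟨by norm_num, LipschitzWith.of_dist_le_mul fun w₁ w₂ => ?_⟩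
    rw [BoundedContinuousFunction.dist_le (by positivity)]
    intro x
    have hx : 0 ≤ max x 0 := le_max_right _ _
    have hd : 0 ≤ dist w₁ w₂ := dist_nonneg
    have hdiff : ‖I w₁ x - I w₂ x‖ ≤
        0 * max x 0 + C * dist w₁ w₂ / l * Real.exp (l * max x 0) := by
      have e : I w₁ x - I w₂ x = ∫ u in (0 : ℝ)..(max x 0),
          radialMean ν (fun v => F (Y w₁ v) - F (Y w₂ v)) u := by
        have : ∀ u, radialMean ν (fun v => F (Y w₁ v) - F (Y w₂ v)) u =
            radialMean ν (fun v => F (Y w₁ v)) u - radialMean ν (fun v => F (Y w₂ v)) u :=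
          fun u => (radialMean_sub hν (hFY w₁) (hFY w₂) u).symm
        simp only [this]
        rw [intervalIntegral.integral_sub
          ((continuous_radialMean hν (hFY w₁)).intervalIntegrable _ _)
          ((continuous_radialMean hν (hFY w₂)).intervalIntegrable _ _)]
      rw [e]
      apply norm_integral_le_of_exp_bound hl0 (by positivity) hx
      intro u hu
      rw [zero_add]
      apply norm_radialMean_le hν
      intro z hz
      have huz0 : 0 ≤ u * z := mul_nonneg hu.1 hz.1
      have huz : u * z ≤ u := mul_le_of_le_one_right hu.1 hz.2
      calc ‖F (Y w₁ (u * z)) - F (Y w₂ (u * z))‖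
          ≤ C * ‖Y w₁ (u * z) - Y w₂ (u * z)‖ := hF.norm_sub_le _ _
        _ = C * (Real.exp (l * (u * z)) * dist (w₁ (u * z)) (w₂ (u * z))) := by
            simp only [Y]
            rw [add_sub_add_left_eq_sub, ← smul_sub, norm_smul,
              Real.norm_of_nonneg (Real.exp_pos _).le, max_eq_left huz0, dist_eq_norm]
        _ ≤ C * (Real.exp (l * u) * dist w₁ w₂) := by
            gcongr
            exact BoundedContinuousFunction.dist_coe_le_dist _
        _ = C * dist w₁ w₂ * Real.exp (l * u) := by ring
    rw [dist_eq_norm, hTa, hTa, ← smul_sub, norm_smul, neg_sub_neg, norm_sub_rev,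
      Real.norm_of_nonneg (Real.exp_pos _).le, Real.exp_neg, inv_mul_le_iff₀ (Real.exp_pos _)]
    have h4 : C * dist w₁ w₂ / l ≤ dist w₁ w₂ / 2 := by
      rw [div_le_div_iff₀ hl0 two_pos]
      rw [hl]; nlinarith
    calc ‖I w₁ x - I w₂ x‖ ≤ C * dist w₁ w₂ / l * Real.exp (l * max x 0) := by
          simpa using hdiff
      _ ≤ dist w₁ w₂ / 2 * Real.exp (l * max x 0) := by gcongr
      _ = _ := by push_cast; ring
  set w := ContractingWith.fixedPoint T hT with hw
  have hfix : T w = w := hT.fixedPoint_isFixedPt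
  refine ⟨Y w, hY w, fun ρ x hx => ?_⟩
  have h1 : w x = Real.exp (-(l * max x 0)) • -(I w x) := by
    rw [← hTa, hfix]
  have hx0 : max x 0 = x := max_eq_left hx.1
  show y₀ + Real.exp (l * max x 0) • w x = _
  rw [h1, smul_smul, ← Real.exp_add]
  simp only [I, hx0]
  simp [sub_eq_add_neg]

lemma rpow_smul_radialMean (ν : ℝ) (g : ℝ → E) {x : ℝ} (hx : 0 < x) :
    x ^ (ν + 1) • radialMean ν g x = ∫ w in (0 : ℝ)..x, w ^ ν • g w := by
  have h := intervalIntegral.smul_integral_comp_mul_left (a := (0:ℝ)) (b := 1)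
    (fun w : ℝ => w ^ ν • g w) x
  rw [mul_zero, mul_one] at h
  rw [← h, radialMean, ← intervalIntegral.integral_smul, ← intervalIntegral.integral_smul]
  apply intervalIntegral.integral_congr
  intro z hz
  rw [uIcc_of_le zero_le_one] at hz
  simp only [smul_smul]
  rw [Real.rpow_add hx, Real.rpow_one, Real.mul_rpow hx.le hz.1]
  ring_nf

lemma SolvesRadial.eq_zero {ν : ℝ} {F : E → E} {y₀ : E} {ρ : ℝ} {y : ℝ → E} (hρ : 0 ≤ ρ)
    (h : SolvesRadial ν F y₀ ρ y) : y 0 = y₀ := by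
  rw [h 0 ⟨le_rfl, hρ⟩]; simp

lemma SolvesRadial.hasDerivAt [CompleteSpace E] {ν : ℝ} (hν : 0 < ν) {F : E → E}
    (hF : Continuous F)
    {y₀ : E} {y : ℝ → E} (hy : Continuous y) (h : ∀ ρ, SolvesRadial ν F y₀ ρ y) {x : ℝ}
    (hx : 0 < x) :
    HasDerivAt y (-(x ^ (-(ν + 1)) • ∫ w in (0 : ℝ)..x, w ^ ν • F (y w))) x := by
  have hc := continuous_radialMean hν (hF.comp hy)
  have h1 : HasDerivAt (fun x => y₀ - ∫ u in (0 : ℝ)..x, radialMean ν (fun v => F (y v)) u)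
      (-(radialMean ν (fun v => F (y v)) x)) x :=
    (intervalIntegral.integral_hasDerivAt_right (hc.intervalIntegrable _ _)
      (hc.stronglyMeasurableAtFilter _ _) hc.continuousAt).const_sub _
  rw [← rpow_smul_radialMean ν (fun v => F (y v)) hx, smul_smul, ← Real.rpow_add hx]
  simp only [neg_add_cancel, Real.rpow_zero, one_smul]
  apply h1.congr_of_eventuallyEq
  filter_upwards [lt_mem_nhds hx] with z hz
  exact h z z ⟨le_of_lt hz, le_rfl⟩

lemma hasDerivAt_flux [CompleteSpace E] {ν : ℝ} (hν : 0 < ν) {g : ℝ → E} (hg : Continuous g)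
    (x : ℝ) : HasDerivAt (fun x => ∫ w in (0 : ℝ)..x, w ^ ν • g w) (x ^ ν • g x) x := by
  have hc : Continuous fun w : ℝ => w ^ ν • g w := (Real.continuous_rpow_const hν.le).smul hg
  exact intervalIntegral.integral_hasDerivAt_right (hc.intervalIntegrable _ _)
      (hc.stronglyMeasurableAtFilter _ _) hc.continuousAt

end RadialEquation

/-! ### Positive solutions of the system: elementary estimates -/

/-- Positive solutions on `[0, ρ]` of the system in the variable `x = r^{a+2}`, written with the
fluxes `M = -x^{ν+1} φ'` and `K = -x^{ν+1} ψ'`, and normalised by `φ(0) = ψ(0) = 1`. -/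
structure IsPosSol (ν s δ μ P Q ρ : ℝ) (φ ψ M K : ℝ → ℝ) : Prop where
  contφ : ContinuousOn φ (Icc 0 ρ)
  contψ : ContinuousOn ψ (Icc 0 ρ)
  contM : ContinuousOn M (Icc 0 ρ)
  contK : ContinuousOn K (Icc 0 ρ)
  φ_zero : φ 0 = 1
  ψ_zero : ψ 0 = 1
  M_zero : M 0 = 0
  K_zero : K 0 = 0
  φ_pos : ∀ x ∈ Icc 0 ρ, 0 < φ x
  ψ_pos : ∀ x ∈ Icc 0 ρ, 0 < ψ x
  hasDerivAt_φ : ∀ x ∈ Ioc 0 ρ, HasDerivAt φ (-(x ^ (-(ν + 1)) * M x)) x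
  hasDerivAt_ψ : ∀ x ∈ Ioc 0 ρ, HasDerivAt ψ (-(x ^ (-(ν + 1)) * K x)) x
  hasDerivAt_M : ∀ x ∈ Ioc 0 ρ, HasDerivAt M (x ^ ν * (P * (φ x ^ s * ψ x ^ δ))) x
  hasDerivAt_K : ∀ x ∈ Ioc 0 ρ, HasDerivAt K (x ^ ν * (Q * (φ x ^ μ * ψ x ^ s))) x

namespace IsPosSol

variable {ν s δ μ P Q ρ : ℝ} {φ ψ M K : ℝ → ℝ}

lemma swap (h : IsPosSol ν s δ μ P Q ρ φ ψ M K) : IsPosSol ν s μ δ Q P ρ ψ φ K M where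
  contφ := h.contψ
  contψ := h.contφ
  contM := h.contK
  contK := h.contM
  φ_zero := h.ψ_zero
  ψ_zero := h.φ_zero
  M_zero := h.K_zero
  K_zero := h.M_zero
  φ_pos := h.ψ_pos
  ψ_pos := h.φ_pos
  hasDerivAt_φ := h.hasDerivAt_ψ
  hasDerivAt_ψ := h.hasDerivAt_φ
  hasDerivAt_M := fun x hx => by
    rw [mul_comm (ψ x ^ s)]; exact h.hasDerivAt_K x hx
  hasDerivAt_K := fun x hx => by
    rw [mul_comm (ψ x ^ δ)]; exact h.hasDerivAt_M x hx

lemma mono (h : IsPosSol ν s δ μ P Q ρ φ ψ M K) {ρ' : ℝ} (hρ : ρ' ≤ ρ) :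
    IsPosSol ν s δ μ P Q ρ' φ ψ M K where
  contφ := h.contφ.mono (Icc_subset_Icc_right hρ)
  contψ := h.contψ.mono (Icc_subset_Icc_right hρ)
  contM := h.contM.mono (Icc_subset_Icc_right hρ)
  contK := h.contK.mono (Icc_subset_Icc_right hρ)
  φ_zero := h.φ_zero
  ψ_zero := h.ψ_zero
  M_zero := h.M_zero
  K_zero := h.K_zero
  φ_pos := fun x hx => h.φ_pos x (Icc_subset_Icc_right hρ hx)
  ψ_pos := fun x hx => h.ψ_pos x (Icc_subset_Icc_right hρ hx)
  hasDerivAt_φ := fun x hx => h.hasDerivAt_φ x (Ioc_subset_Ioc_right hρ hx)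
  hasDerivAt_ψ := fun x hx => h.hasDerivAt_ψ x (Ioc_subset_Ioc_right hρ hx)
  hasDerivAt_M := fun x hx => h.hasDerivAt_M x (Ioc_subset_Ioc_right hρ hx)
  hasDerivAt_K := fun x hx => h.hasDerivAt_K x (Ioc_subset_Ioc_right hρ hx)

end IsPosSol

lemma monotoneOn_Icc_of_hasDerivAt {f f' : ℝ → ℝ} {a b : ℝ} (hf : ContinuousOn f (Icc a b))
    (hd : ∀ x ∈ Ioo a b, HasDerivAt f (f' x) x) (h0 : ∀ x ∈ Ioo a b, 0 ≤ f' x) :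
    MonotoneOn f (Icc a b) := by
  apply monotoneOn_of_deriv_nonneg (convex_Icc a b) hf
  · rw [interior_Icc]
    exact fun x hx => (hd x hx).differentiableAt.differentiableWithinAt
  · rw [interior_Icc]
    intro x hx
    rw [(hd x hx).deriv]
    exact h0 x hx

lemma antitoneOn_Icc_of_hasDerivAt {f f' : ℝ → ℝ} {a b : ℝ} (hf : ContinuousOn f (Icc a b))
    (hd : ∀ x ∈ Ioo a b, HasDerivAt f (f' x) x) (h0 : ∀ x ∈ Ioo a b, f' x ≤ 0) :
    AntitoneOn f (Icc a b) := by
  apply antitoneOn_of_deriv_nonpos (convex_Icc a b) hf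
  · rw [interior_Icc]
    exact fun x hx => (hd x hx).differentiableAt.differentiableWithinAt
  · rw [interior_Icc]
    intro x hx
    rw [(hd x hx).deriv]
    exact h0 x hx

namespace IsPosSol

variable {ν s δ μ P Q ρ : ℝ} {φ ψ M K : ℝ → ℝ}

lemma source_nonneg (h : IsPosSol ν s δ μ P Q ρ φ ψ M K) (hP : 0 ≤ P) :
    ∀ x ∈ Icc 0 ρ, 0 ≤ x ^ ν * (P * (φ x ^ s * ψ x ^ δ)) := fun x hx => by
  have h1 := h.φ_pos x hx
  have h2 := h.ψ_pos x hx
  have h3 := hx.1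
  positivity

lemma monotoneOn_M (h : IsPosSol ν s δ μ P Q ρ φ ψ M K) (hP : 0 ≤ P) :
    MonotoneOn M (Icc 0 ρ) :=
  monotoneOn_Icc_of_hasDerivAt h.contM (fun x hx => h.hasDerivAt_M x ⟨hx.1, hx.2.le⟩)
    fun x hx => h.source_nonneg hP x ⟨hx.1.le, hx.2.le⟩

lemma M_nonneg (h : IsPosSol ν s δ μ P Q ρ φ ψ M K) (hP : 0 ≤ P) {x : ℝ} (hx : x ∈ Icc 0 ρ) :
    0 ≤ M x := by
  have := h.monotoneOn_M hP ⟨le_rfl, hx.1.trans hx.2⟩ hx hx.1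
  rwa [h.M_zero] at this

lemma antitoneOn_φ (h : IsPosSol ν s δ μ P Q ρ φ ψ M K) (hP : 0 ≤ P) :
    AntitoneOn φ (Icc 0 ρ) :=
  antitoneOn_Icc_of_hasDerivAt h.contφ (fun x hx => h.hasDerivAt_φ x ⟨hx.1, hx.2.le⟩)
    fun x hx => by
      have h1 := h.M_nonneg hP ⟨hx.1.le, hx.2.le⟩
      have h2 := hx.1
      have : 0 ≤ x ^ (-(ν + 1)) * M x := by positivity
      linarith

lemma φ_le_one (h : IsPosSol ν s δ μ P Q ρ φ ψ M K) (hP : 0 ≤ P) {x : ℝ} (hx : x ∈ Icc 0 ρ) :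
    φ x ≤ 1 := by
  have := h.antitoneOn_φ hP ⟨le_rfl, hx.1.trans hx.2⟩ hx hx.1
  rwa [h.φ_zero] at this

lemma source_antitone (h : IsPosSol ν s δ μ P Q ρ φ ψ M K) (hP : 0 ≤ P) (hQ : 0 ≤ Q)
    (hs : 0 < s) (hδ : 0 < δ) {x y : ℝ} (hx : x ∈ Icc 0 ρ) (hy : y ∈ Icc 0 ρ) (hxy : x ≤ y) :
    φ y ^ s * ψ y ^ δ ≤ φ x ^ s * ψ x ^ δ := by
  have h1 := h.antitoneOn_φ hP hx hy hxy
  have h2 := h.swap.antitoneOn_φ hQ hx hy hxy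
  have h3 := h.φ_pos y hy
  have h4 := h.ψ_pos y hy
  have h5 := h.φ_pos x hx
  gcongr

lemma hasDerivAt_rpow_div (hν : 0 < ν) {x : ℝ} (hx : 0 < x) :
    HasDerivAt (fun x : ℝ => x ^ (ν + 1) / (ν + 1)) (x ^ ν) x := by
  have := (Real.hasDerivAt_rpow_const (x := x) (p := ν + 1) (Or.inl hx.ne')).div_const (ν + 1)
  refine this.congr_deriv ?_
  have : ν + 1 ≠ 0 := by positivity
  rw [add_sub_cancel_right]
  field_simp

/-- As `φ, ψ ≤ 1`, the flux is at most that of the constant source `P`. -/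
lemma M_le (h : IsPosSol ν s δ μ P Q ρ φ ψ M K) (hP : 0 ≤ P) (hQ : 0 ≤ Q) (hν : 0 < ν)
    (hs : 0 < s) (hδ : 0 < δ) {x : ℝ} (hx : x ∈ Icc 0 ρ) :
    M x ≤ P * (x ^ (ν + 1) / (ν + 1)) := by
  have hc : Continuous fun x : ℝ => P * (x ^ (ν + 1) / (ν + 1)) :=
    continuous_const.mul ((Real.continuous_rpow_const (by positivity)).div_const _)
  have h1 : MonotoneOn (fun x => P * (x ^ (ν + 1) / (ν + 1)) - M x) (Icc 0 ρ) := by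
    apply monotoneOn_Icc_of_hasDerivAt (hc.continuousOn.sub h.contM)
    · intro x hx
      exact ((hasDerivAt_rpow_div hν hx.1).const_mul P).sub (h.hasDerivAt_M x ⟨hx.1, hx.2.le⟩)
    · intro x hx
      have h2 := h.source_antitone hP hQ hs hδ ⟨le_rfl, (hx.1.trans hx.2).le⟩
        ⟨hx.1.le, hx.2.le⟩ hx.1.le
      rw [h.φ_zero, h.ψ_zero, Real.one_rpow, Real.one_rpow, mul_one] at h2
      have h3 : x ^ ν * (P * (φ x ^ s * ψ x ^ δ)) ≤ x ^ ν * (P * 1) := by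
        have := hx.1
        gcongr
      linarith
  have := h1 ⟨le_rfl, hx.1.trans hx.2⟩ hx hx.1
  have h0 : ν + 1 ≠ 0 := by positivity
  simp only [h.M_zero, Real.zero_rpow h0, zero_div, mul_zero] at this
  linarith

/-- As the source `φ^s ψ^δ` is decreasing, the flux is at least its present value times the volume. -/
lemma source_mul_le_M (h : IsPosSol ν s δ μ P Q ρ φ ψ M K) (hP : 0 ≤ P) (hQ : 0 ≤ Q)
    (hν : 0 < ν) (hs : 0 < s) (hδ : 0 < δ) {x : ℝ} (hx : x ∈ Icc 0 ρ) :
    P * (φ x ^ s * ψ x ^ δ) * (x ^ (ν + 1) / (ν + 1)) ≤ M x := by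
  have h' := h.mono hx.2
  have hc : Continuous fun z : ℝ => P * (φ x ^ s * ψ x ^ δ) * (z ^ (ν + 1) / (ν + 1)) :=
    continuous_const.mul ((Real.continuous_rpow_const (by positivity)).div_const _)
  have h1 : MonotoneOn (fun z => M z - P * (φ x ^ s * ψ x ^ δ) * (z ^ (ν + 1) / (ν + 1)))
      (Icc 0 x) := by
    apply monotoneOn_Icc_of_hasDerivAt (h'.contM.sub hc.continuousOn)
    · intro z hz
      exact (h'.hasDerivAt_M z ⟨hz.1, hz.2.le⟩).sub
        ((hasDerivAt_rpow_div hν hz.1).const_mul _)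
    · intro z hz
      have h2 := h'.source_antitone hP hQ hs hδ ⟨hz.1.le, hz.2.le⟩
        ⟨hx.1, le_rfl⟩ hz.2.le
      have h3 : z ^ ν * (P * (φ x ^ s * ψ x ^ δ)) ≤ z ^ ν * (P * (φ z ^ s * ψ z ^ δ)) := by
        have := hz.1
        gcongr
      linarith
  have := h1 ⟨le_rfl, hx.1⟩ ⟨hx.1, le_rfl⟩ hx.1
  have h0 : ν + 1 ≠ 0 := by positivity
  simp only [h.M_zero, Real.zero_rpow h0, zero_div, mul_zero] at this
  linarith

/-- The derivative of `φ` is bounded below by `-P/(ν+1)`. -/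
lemma φ_sub_le (h : IsPosSol ν s δ μ P Q ρ φ ψ M K) (hP : 0 ≤ P) (hQ : 0 ≤ Q) (hν : 0 < ν)
    (hs : 0 < s) (hδ : 0 < δ) {x y : ℝ} (hx : 0 ≤ x) (hxy : x ≤ y) (hy : y ≤ ρ) :
    φ x - P * (y - x) / (ν + 1) ≤ φ y := by
  have h1 : MonotoneOn (fun z => φ z + P * z / (ν + 1)) (Icc x y) := by
    apply monotoneOn_Icc_of_hasDerivAt
      (f' := fun z => -(z ^ (-(ν + 1)) * M z) + P * 1 / (ν + 1))
      ((h.contφ.mono (Icc_subset_Icc hx hy)).add (Continuous.continuousOn (by fun_prop)))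
    · intro z hz
      exact (h.hasDerivAt_φ z ⟨hx.trans_lt hz.1, hz.2.le.trans hy⟩).add
        (((hasDerivAt_id z).const_mul P).div_const (ν + 1))
    · intro z hz
      have hz0 := hx.trans_lt hz.1
      have h2 := h.M_le hP hQ hν hs hδ ⟨hz0.le, hz.2.le.trans hy⟩
      have h3 : z ^ (-(ν + 1)) * M z ≤ z ^ (-(ν + 1)) * (P * (z ^ (ν + 1) / (ν + 1))) := by
        gcongr
      have h4 : z ^ (-(ν + 1)) * (P * (z ^ (ν + 1) / (ν + 1))) = P * 1 / (ν + 1) := by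
        rw [Real.rpow_neg hz0.le]
        have := Real.rpow_pos_of_pos hz0 (ν + 1)
        field_simp
      linarith
  have := h1 ⟨le_rfl, hxy⟩ ⟨hxy, le_rfl⟩ hxy
  simp only at this
  have e : P * (y - x) / (ν + 1) = P * y / (ν + 1) - P * x / (ν + 1) := by ring
  linarith

/-- If at `ρ₁` the value of `φ` is small compared with the flux, then `φ` cannot stay positive up
to `ρ₁ + k`. -/
lemma lt_add_of_φ_lt (h : IsPosSol ν s δ μ P Q ρ φ ψ M K) (hP : 0 ≤ P) (hν : 0 < ν)
    {ρ₁ k : ℝ} (hρ₁ : 0 < ρ₁) (hk : 0 < k) (hρ : ρ₁ ≤ ρ)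
    (hc : φ ρ₁ * (ρ₁ + k) ^ (ν + 1) < M ρ₁ * k) : ρ < ρ₁ + k := by
  by_contra! hle
  have hk1 : 0 < ρ₁ + k := by positivity
  have hc' : φ ρ₁ < M ρ₁ * k * (ρ₁ + k) ^ (-(ν + 1)) := by
    rwa [Real.rpow_neg hk1.le, ← div_eq_mul_inv, lt_div_iff₀ (Real.rpow_pos_of_pos hk1 _)]
  have h1 : AntitoneOn (fun z => φ z + M ρ₁ * (ρ₁ + k) ^ (-(ν + 1)) * z) (Icc ρ₁ (ρ₁ + k)) := by
    apply antitoneOn_Icc_of_hasDerivAt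
      (f' := fun z => -(z ^ (-(ν + 1)) * M z) + M ρ₁ * (ρ₁ + k) ^ (-(ν + 1)) * 1)
      ((h.contφ.mono (Icc_subset_Icc hρ₁.le hle)).add (Continuous.continuousOn (by fun_prop)))
    · intro z hz
      exact (h.hasDerivAt_φ z ⟨hρ₁.trans hz.1, hz.2.le.trans hle⟩).add
        ((hasDerivAt_id z).const_mul _)
    · intro z hz
      have hz0 := hρ₁.trans hz.1
      have h2 : M ρ₁ ≤ M z := h.monotoneOn_M hP ⟨hρ₁.le, hρ⟩ ⟨hz0.le, hz.2.le.trans hle⟩ hz.1.le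
      have h3 : (ρ₁ + k) ^ (-(ν + 1)) ≤ z ^ (-(ν + 1)) :=
        Real.rpow_le_rpow_of_nonpos hz0 hz.2.le (by linarith)
      have h4 := h.M_nonneg hP ⟨hρ₁.le, hρ⟩
      have h5 : M ρ₁ * (ρ₁ + k) ^ (-(ν + 1)) ≤ M z * z ^ (-(ν + 1)) :=
        mul_le_mul h2 h3 (Real.rpow_nonneg (by linarith) _) (h4.trans h2)
      linarith
  have h2 := h1 ⟨le_rfl, by linarith⟩ ⟨by linarith, le_rfl⟩ (by linarith)
  simp only at h2
  have h3 := h.φ_pos (ρ₁ + k) ⟨by linarith, hle⟩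
  nlinarith

/-! ### Logarithmic derivatives along positive solutions -/

/-- With `X = -x φ'/φ` and `S = x P φ^{s-1} ψ^δ` one has
`x X' = X (X - ν) + S`. -/
lemma hasDerivAt_slope (h : IsPosSol ν s δ μ P Q ρ φ ψ M K) {x : ℝ} (hx : x ∈ Ioc 0 ρ) :
    HasDerivAt (fun x => x ^ (-ν) * M x / φ x)
      (((x ^ (-ν) * M x / φ x) * (x ^ (-ν) * M x / φ x - ν)
        + x * (P * (φ x ^ (s - 1) * ψ x ^ δ))) / x) x := by
  have hx0 := hx.1
  have hφ := h.φ_pos x ⟨hx0.le, hx.2⟩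
  have h1 := ((Real.hasDerivAt_rpow_const (x := x) (p := -ν) (Or.inl hx0.ne')).mul
    (h.hasDerivAt_M x hx)).div (h.hasDerivAt_φ x hx) hφ.ne'
  refine h1.congr_deriv ?_
  simp only [Pi.mul_apply]
  rw [Real.rpow_sub_one hx0.ne', Real.rpow_sub_one hφ.ne', neg_add', Real.rpow_sub_one hx0.ne',
    Real.rpow_neg hx0.le]
  have := Real.rpow_pos_of_pos hx0 ν
  field_simp
  ring

/-- With `X = -x φ'/φ`, `Y = -x ψ'/ψ` and `S = x P φ^{s-1} ψ^δ` one has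
`x S' = S (1 - (s-1) X - δ Y)`. -/
lemma hasDerivAt_log_source (h : IsPosSol ν s δ μ P Q ρ φ ψ M K) {x : ℝ} (hx : x ∈ Ioc 0 ρ) :
    HasDerivAt (fun x => x * (P * (φ x ^ (s - 1) * ψ x ^ δ)))
      ((x * (P * (φ x ^ (s - 1) * ψ x ^ δ))) * (1 - (s - 1) * (x ^ (-ν) * M x / φ x)
        - δ * (x ^ (-ν) * K x / ψ x)) / x) x := by
  have hx0 := hx.1
  have hφ := h.φ_pos x ⟨hx0.le, hx.2⟩
  have hψ := h.ψ_pos x ⟨hx0.le, hx.2⟩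
  have h1 := (hasDerivAt_id x).mul ((((h.hasDerivAt_φ x hx).rpow_const (p := s - 1)
    (Or.inl hφ.ne')).mul ((h.hasDerivAt_ψ x hx).rpow_const (p := δ)
    (Or.inl hψ.ne'))).const_mul P)
  refine h1.congr_deriv ?_
  simp only [Pi.mul_apply, id]
  rw [Real.rpow_sub_one hφ.ne' (s - 1), Real.rpow_sub_one hψ.ne', neg_add',
    Real.rpow_sub_one hx0.ne']
  field_simp
  ring

lemma hasDerivAt_weight (h : IsPosSol ν s δ μ P Q ρ φ ψ M K) {x : ℝ} (hx : x ∈ Ioc 0 ρ) :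
    HasDerivAt (fun x => x ^ ν * (φ x * ψ x))
      (x ^ ν * (φ x * ψ x) * (ν - x ^ (-ν) * M x / φ x - x ^ (-ν) * K x / ψ x) / x) x := by
  have hx0 := hx.1
  have hφ := h.φ_pos x ⟨hx0.le, hx.2⟩
  have hψ := h.ψ_pos x ⟨hx0.le, hx.2⟩
  have h1 := (Real.hasDerivAt_rpow_const (x := x) (p := ν) (Or.inl hx0.ne')).mul
    ((h.hasDerivAt_φ x hx).mul (h.hasDerivAt_ψ x hx))
  refine h1.congr_deriv ?_
  simp only [Pi.mul_apply]
  rw [Real.rpow_sub_one hx0.ne', neg_add', Real.rpow_sub_one hx0.ne']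
  field_simp
  ring

end IsPosSol

/-! ### Pohozaev-type energy of the system -/

lemma nonpos_of_hasDerivAt_nonpos {G G' : ℝ → ℝ} {ρ : ℝ} (hρ : 0 < ρ)
    (hd : ∀ x ∈ Ioc 0 ρ, HasDerivAt G (G' x) x) (h0 : ∀ x ∈ Ioc 0 ρ, G' x ≤ 0)
    (hG : Tendsto G (𝓝[>] 0) (𝓝 0)) : G ρ ≤ 0 := by
  apply ge_of_tendsto hG
  filter_upwards [Ioo_mem_nhdsGT hρ] with y hy
  have : AntitoneOn G (Icc y ρ) := by
    apply antitoneOn_Icc_of_hasDerivAt (f' := G')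
    · exact fun x hx => (hd x ⟨hy.1.trans_le hx.1, hx.2⟩).continuousAt.continuousWithinAt
    · exact fun x hx => hd x ⟨hy.1.trans hx.1, hx.2.le⟩
    · exact fun x hx => h0 x ⟨hy.1.trans hx.1, hx.2.le⟩
  exact this ⟨le_rfl, hy.2.le⟩ ⟨hy.2.le, le_rfl⟩ hy.2.le

/-- The cubic inequality that makes the Pohozaev-type energy monotone; both factors of the
decomposition in powers of `T - ν` are nonnegative. -/
lemma cubic_slope_inequality {ν X Y T : ℝ} (hν : 0 < ν) (hX : 0 ≤ X) (hY : 0 ≤ Y) (hXT : X ≤ T)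
    (hYT : Y ≤ T) (hT : ν ≤ T) :
    X ^ 2 * (X - Y - ν) + Y ^ 2 * (Y - X - ν) + ν * (X * Y) ≤
      T ^ 2 * (2 * T - 2 * ν - X - Y) + ν * T * (X + Y) := by
  have hT0 : 0 < T := hν.trans_le hT
  have h1 : 0 ≤ 2 * T ^ 3 - T ^ 2 * (X + Y) - (X - Y) ^ 2 * (X + Y) := by
    rcases le_total Y X with h | h
    · have a1 : (X - Y) * (X ^ 2 - Y ^ 2) ≤ (T - Y) * T ^ 2 := by
        apply mul_le_mul (by linarith) (by nlinarith) (by nlinarith) (by linarith)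
      nlinarith [mul_nonneg (sub_nonneg.2 hXT) (sq_nonneg T)]
    · have a1 : (Y - X) * (Y ^ 2 - X ^ 2) ≤ (T - X) * T ^ 2 := by
        apply mul_le_mul (by linarith) (by nlinarith) (by nlinarith) (by linarith)
      nlinarith [mul_nonneg (sub_nonneg.2 hYT) (sq_nonneg T)]
  have h2 : 0 ≤ X ^ 2 * (T - X) + Y ^ 2 * (T - Y) - X * Y * (T - X - Y) := by
    have b1 := mul_nonneg (sq_nonneg X) (sub_nonneg.2 hXT)
    have b2 := mul_nonneg (sq_nonneg Y) (sub_nonneg.2 hYT)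
    rcases le_total T (X + Y) with h | h
    · have := mul_nonneg (mul_nonneg hX hY) (sub_nonneg.2 h)
      nlinarith
    · have c1 : X ^ 2 * (T - X - Y) ≤ X ^ 2 * (T - X) :=
        mul_le_mul_of_nonneg_left (by linarith) (sq_nonneg X)
      have c2 : Y ^ 2 * (T - X - Y) ≤ Y ^ 2 * (T - Y) :=
        mul_le_mul_of_nonneg_left (by linarith) (sq_nonneg Y)
      have c3 : 0 ≤ (X ^ 2 + Y ^ 2 - X * Y) * (T - X - Y) :=
        mul_nonneg (by nlinarith [sq_nonneg (X - Y)]) (by linarith)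
      nlinarith
  have h3 : 0 ≤ T * (T ^ 2 * (2 * T - 2 * ν - X - Y) + ν * T * (X + Y) -
      (X ^ 2 * (X - Y - ν) + Y ^ 2 * (Y - X - ν) + ν * (X * Y))) := by
    have := add_nonneg (mul_nonneg (sub_nonneg.2 hT) h1) (mul_nonneg hν.le h2)
    linarith
  have := nonneg_of_mul_nonneg_right h3 hT0
  linarith

lemma sq_add_sq_sub_max_pos {a b ν : ℝ} (hν : 0 < ν) (h : 0 < max a b) :
    0 < a ^ 2 + b ^ 2 - max a b ^ 2 + ν * max a b := by
  have := mul_pos hν h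
  rcases le_total a b with h' | h'
  · rw [max_eq_right h'] at this ⊢
    nlinarith [sq_nonneg a]
  · rw [max_eq_left h'] at this ⊢
    nlinarith [sq_nonneg b]

namespace IsPosSol

variable {ν s δ μ P Q ρ : ℝ} {φ ψ M K : ℝ → ℝ}

lemma slope_nonneg (h : IsPosSol ν s δ μ P Q ρ φ ψ M K) (hP : 0 ≤ P) {x : ℝ}
    (hx : x ∈ Icc 0 ρ) : 0 ≤ x ^ (-ν) * M x / φ x := by
  have h1 := h.φ_pos x hx
  have h2 := h.M_nonneg hP hx
  have h3 := hx.1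
  positivity

lemma log_source_nonneg (h : IsPosSol ν s δ μ P Q ρ φ ψ M K) (hP : 0 ≤ P) {x : ℝ}
    (hx : x ∈ Icc 0 ρ) : 0 ≤ x * (P * (φ x ^ (s - 1) * ψ x ^ δ)) := by
  have h1 := h.φ_pos x hx
  have h2 := h.ψ_pos x hx
  have h3 := hx.1
  positivity

lemma tendsto_φ (h : IsPosSol ν s δ μ P Q ρ φ ψ M K) (hρ : 0 < ρ) :
    Tendsto φ (𝓝[>] 0) (𝓝 1) := by
  have h1 := (h.contφ 0 ⟨le_rfl, hρ.le⟩).tendsto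
  rw [h.φ_zero] at h1
  exact h1.mono_left (nhdsWithin_le_of_mem (mem_of_superset (Ioo_mem_nhdsGT hρ)
    fun x hx => ⟨hx.1.le, hx.2.le⟩))

lemma tendsto_slope (h : IsPosSol ν s δ μ P Q ρ φ ψ M K) (hP : 0 ≤ P) (hQ : 0 ≤ Q) (hν : 0 < ν)
    (hs : 0 < s) (hδ : 0 < δ) (hρ : 0 < ρ) :
    Tendsto (fun x => x ^ (-ν) * M x / φ x) (𝓝[>] 0) (𝓝 0) := by
  have h0 : Tendsto (fun x : ℝ => x) (𝓝[>] 0) (𝓝 0) := tendsto_nhdsWithin_of_tendsto_nhds tendsto_id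
  have h1 : Tendsto (fun x : ℝ => P * (x / (ν + 1)) / φ x) (𝓝[>] 0) (𝓝 0) := by
    have : Tendsto (fun x : ℝ => P * (x / (ν + 1)) / φ x) (𝓝[>] 0)
        (𝓝 (P * (0 / (ν + 1)) / 1)) :=
      ((h0.div_const (ν + 1)).const_mul P).div (h.tendsto_φ hρ) one_ne_zero
    simpa using this
  apply squeeze_zero' _ _ h1
  · filter_upwards [Ioo_mem_nhdsGT hρ] with x hx
    exact h.slope_nonneg hP ⟨hx.1.le, hx.2.le⟩
  · filter_upwards [Ioo_mem_nhdsGT hρ] with x hx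
    have hm : x ∈ Icc 0 ρ := ⟨hx.1.le, hx.2.le⟩
    have hφ := h.φ_pos x hm
    have hx0 := hx.1
    have h2 : x ^ (-ν) * M x ≤ x ^ (-ν) * (P * (x ^ (ν + 1) / (ν + 1))) := by
      gcongr
      exact h.M_le hP hQ hν hs hδ hm
    have h3 : x ^ (-ν) * (P * (x ^ (ν + 1) / (ν + 1))) = P * (x / (ν + 1)) := by
      rw [Real.rpow_neg hx0.le, Real.rpow_add_one hx0.ne']
      have := Real.rpow_pos_of_pos hx0 ν
      field_simp
    rw [h3] at h2
    gcongr

lemma tendsto_log_source (h : IsPosSol ν s δ μ P Q ρ φ ψ M K) (hρ : 0 < ρ) :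
    Tendsto (fun x => x * (P * (φ x ^ (s - 1) * ψ x ^ δ))) (𝓝[>] 0) (𝓝 0) := by
  have h0 : Tendsto (fun x : ℝ => x) (𝓝[>] 0) (𝓝 0) := tendsto_nhdsWithin_of_tendsto_nhds tendsto_id
  have h1 := (h.tendsto_φ hρ).rpow_const (p := s - 1) (Or.inl one_ne_zero)
  have h2 := (h.swap.tendsto_φ hρ).rpow_const (p := δ) (Or.inl one_ne_zero)
  simpa using h0.mul ((h1.mul h2).const_mul P)

lemma tendsto_weight (h : IsPosSol ν s δ μ P Q ρ φ ψ M K) (hν : 0 < ν) (hρ : 0 < ρ) :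
    Tendsto (fun x => x ^ ν * (φ x * ψ x)) (𝓝[>] 0) (𝓝 0) := by
  have h0 : Tendsto (fun x : ℝ => x) (𝓝[>] 0) (𝓝 0) := tendsto_nhdsWithin_of_tendsto_nhds tendsto_id
  have h1 := h0.rpow_const (p := ν) (Or.inr hν.le)
  rw [Real.zero_rpow hν.ne'] at h1
  simpa using h1.mul ((h.tendsto_φ hρ).mul (h.swap.tendsto_φ hρ))

/-- Comparison of the slope of `φ` with the slope `T = ν / (1 - k x^ν)` of the harmonic function
`x^{-ν} - k`. -/
lemma slope_le (h : IsPosSol ν s δ μ P Q ρ φ ψ M K) (hP : 0 ≤ P) (hρ : 0 < ρ)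
    {k : ℝ} (hk : 0 ≤ k) (hkρ : k * ρ ^ ν < 1) (hν : 0 < ν)
    (hend : ρ ^ (-ν) * M ρ / φ ρ ≤ ν / (1 - k * ρ ^ ν)) {x : ℝ} (hx : x ∈ Ioc 0 ρ) :
    x ^ (-ν) * M x / φ x ≤ ν / (1 - k * x ^ ν) := by
  have key : ∀ z ∈ Ioc 0 ρ, (z ^ (-ν) * M z / φ z ≤ ν / (1 - k * z ^ ν) ↔
      0 ≤ ν * φ z - M z * (z ^ (-ν) - k)) := by
    intro z hz
    have hφ := h.φ_pos z ⟨hz.1.le, hz.2⟩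
    have hz0 := hz.1
    have h1 : k * z ^ ν ≤ k * ρ ^ ν := by
      gcongr
      exact hz.2
    have h2 : 0 < 1 - k * z ^ ν := by linarith
    have hp := Real.rpow_pos_of_pos hz0 ν
    rw [div_le_div_iff₀ hφ h2, Real.rpow_neg hz0.le]
    have e : (z ^ ν)⁻¹ * M z * (1 - k * z ^ ν) = M z * ((z ^ ν)⁻¹ - k) := by
      field_simp
    rw [e]
    constructor <;> intro h <;> linarith
  rw [key x hx]
  refine ((key ρ ⟨hρ, le_rfl⟩).1 hend).trans ?_
  have hder : ∀ z ∈ Ioc 0 ρ, HasDerivAt (fun z => ν * φ z - M z * (z ^ (-ν) - k))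
      (-(z ^ ν * (P * (φ z ^ s * ψ z ^ δ)) * (z ^ (-ν) - k))) z := by
    intro z hz
    have hz0 := hz.1
    have := ((h.hasDerivAt_φ z hz).const_mul ν).sub ((h.hasDerivAt_M z hz).mul
      ((Real.hasDerivAt_rpow_const (x := z) (p := -ν) (Or.inl hz0.ne')).sub_const k))
    refine this.congr_deriv ?_
    rw [show -(ν + 1) = -ν - 1 by ring]
    ring
  have hanti : AntitoneOn (fun z => ν * φ z - M z * (z ^ (-ν) - k)) (Icc x ρ) := by
    apply antitoneOn_Icc_of_hasDerivAt
    · exact fun z hz => (hder z ⟨hx.1.trans_le hz.1, hz.2⟩).continuousAt.continuousWithinAt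
    · exact fun z hz => hder z ⟨hx.1.trans hz.1, hz.2.le⟩
    · intro z hz
      have hz0 := hx.1.trans hz.1
      have h1 := h.source_nonneg hP z ⟨hz0.le, hz.2.le⟩
      have h2 : 0 ≤ z ^ (-ν) - k := by
        have h3 : k * z ^ ν ≤ k * ρ ^ ν := by
          gcongr
          exact hz.2.le
        have hp := Real.rpow_pos_of_pos hz0 ν
        rw [Real.rpow_neg hz0.le, sub_nonneg, ← one_div, le_div_iff₀ hp]
        linarith
      have := mul_nonneg h1 h2
      linarith
  exact hanti ⟨le_rfl, hx.2⟩ ⟨hx.2, le_rfl⟩ hx.2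

lemma hasDerivAt_harmonic_slope {ν k x : ℝ} (hx : 0 < x) (hk : k * x ^ ν < 1) :
    HasDerivAt (fun x => ν / (1 - k * x ^ ν))
      (ν / (1 - k * x ^ ν) * (ν / (1 - k * x ^ ν) - ν) / x) x := by
  have h1 : 1 - k * x ^ ν ≠ 0 := by linarith
  have := (hasDerivAt_const x ν).div
    (((Real.hasDerivAt_rpow_const (x := x) (p := ν) (Or.inl hx.ne')).const_mul k).const_sub 1) h1
  refine this.congr_deriv ?_
  rw [Real.rpow_sub_one hx.ne']
  field_simp
  ring

/-- Derivative of the Pohozaev-type energy, in terms of the logarithmic quantities. -/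
lemma hasDerivAt_energy {ν s δ μ i j c x : ℝ} {w X Y S V T : ℝ → ℝ}
    (hi : i * (δ + 1) = 1) (hj : j * (μ + 1) = 1)
    (hw : HasDerivAt w (w x * (ν - X x - Y x) / x) x)
    (hX : HasDerivAt X ((X x * (X x - ν) + S x) / x) x)
    (hY : HasDerivAt Y ((Y x * (Y x - ν) + V x) / x) x)
    (hS : HasDerivAt S (S x * (1 - (s - 1) * X x - δ * Y x) / x) x)
    (hV : HasDerivAt V (V x * (1 - (s - 1) * Y x - μ * X x) / x) x)
    (hT : HasDerivAt T (T x * (T x - ν) / x) x) :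
    HasDerivAt (fun x => w x * (X x * Y x + i * S x + j * V x - (ν + 1) * j * Y x
        - (ν + 1) * i * X x + c * (X x ^ 2 + Y x ^ 2 - T x ^ 2 + ν * T x)))
      (w x * (((ν + 1) * j + (ν + 1) * i - ν) * (X x * Y x)
        - (s * i - 2 * c) * (X x * S x) - (s * j - 2 * c) * (Y x * V x)
        + c * (X x ^ 2 * (X x - Y x - ν) + Y x ^ 2 * (Y x - X x - ν)
          - (T x ^ 2 * (2 * T x - 2 * ν - X x - Y x) + ν * T x * (X x + Y x)))) / x) x := by
  have := hw.mul ((((((hX.mul hY).add (hS.const_mul i)).add (hV.const_mul j)).sub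
    (hY.const_mul ((ν + 1) * j))).sub (hX.const_mul ((ν + 1) * i))).add
    (((((hX.pow 2).add (hY.pow 2)).sub (hT.pow 2)).add (hT.const_mul ν)).const_mul c))
  refine this.congr_deriv ?_
  simp only [Pi.mul_apply, Pi.add_apply, Pi.sub_apply, Pi.pow_apply, Nat.cast_ofNat]
  linear_combination (-(w x * S x * Y x / x)) * hi + (-(w x * V x * X x / x)) * hj

/-- The derivative of the energy is nonpositive. The hypothesis on `A` and `B` is the cubic
inequality, and `hab` is the position of `(δ, μ)` above the curve. -/
lemma energy_rate_nonpos {ν i j c s X Y S V A B : ℝ} (hc : 0 ≤ c) (hci : 2 * c ≤ s * i)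
    (hcj : 2 * c ≤ s * j) (hab : (ν + 1) * j + (ν + 1) * i - ν - c * ν ≤ 0)
    (hAB : A + ν * (X * Y) ≤ B) (hXY : 0 ≤ X * Y) (hXS : 0 ≤ X * S) (hYV : 0 ≤ Y * V) :
    ((ν + 1) * j + (ν + 1) * i - ν) * (X * Y) - (s * i - 2 * c) * (X * S)
      - (s * j - 2 * c) * (Y * V) + c * (A - B) ≤ 0 := by
  have h5 := mul_le_mul_of_nonneg_left hAB hc
  have h6 := mul_nonneg (sub_nonneg.2 hci) hXS
  have h7 := mul_nonneg (sub_nonneg.2 hcj) hYV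
  have h8 := mul_nonneg (neg_nonneg.2 hab) hXY
  linarith

/-- The energy is positive where both slopes are large. -/
lemma energy_pos {ν i j c X Y S V A : ℝ} (hν : 0 < ν) (hc : 0 < c) (hi : 0 ≤ i) (hj : 0 ≤ j)
    (hi1 : i ≤ 1) (hj1 : j ≤ 1) (hX : 2 * (ν + 1) ≤ X) (hY : 2 * (ν + 1) ≤ Y) (hA : 0 < A)
    (hS : 0 ≤ S) (hV : 0 ≤ V) :
    0 < X * Y + i * S + j * V - (ν + 1) * j * Y - (ν + 1) * i * X + c * A := by
  have a4 := mul_pos hc hA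
  have a5 := mul_nonneg hi hS
  have a6 := mul_nonneg hj hV
  have a7 : (ν + 1) * j * Y ≤ X / 2 * Y := by
    apply mul_le_mul_of_nonneg_right _ (by linarith)
    nlinarith
  have a8 : (ν + 1) * i * X ≤ Y / 2 * X := by
    apply mul_le_mul_of_nonneg_right _ (by linarith)
    nlinarith
  linarith

/-- Above the curve, the two slopes cannot both be large at the same point: in particular the two
components cannot vanish simultaneously. -/
theorem not_large_slopes (h : IsPosSol ν s δ μ P Q ρ φ ψ M K) (hP : 0 ≤ P) (hQ : 0 ≤ Q)
    (hν : 0 < ν) (hs : 0 < s) (hδ : 0 < δ) (hμ : 0 < μ) (hρ : 0 < ρ)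
    (habove : (ν + 1) / (μ + 1) + (ν + 1) / (δ + 1) <
      ν + ν * s / 2 * min (1 / (μ + 1)) (1 / (δ + 1)))
    (hX : max ν (2 * (ν + 1)) ≤ ρ ^ (-ν) * M ρ / φ ρ)
    (hY : max ν (2 * (ν + 1)) ≤ ρ ^ (-ν) * K ρ / ψ ρ) : False := by
  set X : ℝ → ℝ := fun x => x ^ (-ν) * M x / φ x with hXd
  set Y : ℝ → ℝ := fun x => x ^ (-ν) * K x / ψ x with hYd
  set S : ℝ → ℝ := fun x => x * (P * (φ x ^ (s - 1) * ψ x ^ δ)) with hSd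
  set V : ℝ → ℝ := fun x => x * (Q * (ψ x ^ (s - 1) * φ x ^ μ)) with hVd
  set w : ℝ → ℝ := fun x => x ^ ν * (φ x * ψ x) with hwd
  set i := 1 / (δ + 1) with hi
  set j := 1 / (μ + 1) with hj
  -- the largest `c` for which the terms `X S` and `Y V` keep a good sign
  set c := s * min j i / 2 with hc
  have hi0 : 0 < i := by positivity
  have hj0 : 0 < j := by positivity
  have hi1 : i ≤ 1 := by rw [hi, div_le_one (by positivity)]; linarith
  have hj1 : j ≤ 1 := by rw [hj, div_le_one (by positivity)]; linarith
  have hc0 : 0 < c := by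
    have := lt_min hj0 hi0
    positivity
  have hci : 2 * c ≤ s * i := by
    have := mul_le_mul_of_nonneg_left (min_le_right j i) hs.le
    rw [hc]; linarith
  have hcj : 2 * c ≤ s * j := by
    have := mul_le_mul_of_nonneg_left (min_le_left j i) hs.le
    rw [hc]; linarith
  have hab : (ν + 1) * j + (ν + 1) * i - ν - c * ν < 0 := by
    have e1 : (ν + 1) / (μ + 1) = (ν + 1) * j := by rw [hj]; ring
    have e2 : (ν + 1) / (δ + 1) = (ν + 1) * i := by rw [hi]; ring
    rw [e1, e2] at habove
    have e3 : ν * s / 2 * min j i = c * ν := by rw [hc]; ring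
    linarith
  set t := max (X ρ) (Y ρ) with ht
  have hρν := Real.rpow_pos_of_pos hρ ν
  have hXρ : max ν (2 * (ν + 1)) ≤ X ρ := hX
  have hYρ : max ν (2 * (ν + 1)) ≤ Y ρ := hY
  have htν : ν ≤ t := (le_max_left _ _).trans (hXρ.trans (le_max_left _ _))
  have ht0 : 0 < t := hν.trans_le htν
  -- `k` is chosen so that the harmonic slope `T` takes the value `t` at `ρ`
  set k := (1 - ν / t) / ρ ^ ν with hk
  have hνt : ν / t ≤ 1 := by rw [div_le_one ht0]; exact htν
  have hk0 : 0 ≤ k := div_nonneg (by linarith) hρν.le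
  have hkρ : k * ρ ^ ν = 1 - ν / t := by rw [hk]; field_simp
  have hνt0 : 0 < ν / t := by positivity
  have hkρ1 : k * ρ ^ ν < 1 := by linarith
  set T : ℝ → ℝ := fun x => ν / (1 - k * x ^ ν) with hTd
  have hTρ : T ρ = t := by
    simp only [hTd]
    rw [hkρ, sub_sub_cancel]
    field_simp
  have hkx : ∀ x ∈ Ioc 0 ρ, k * x ^ ν ≤ k * ρ ^ ν := fun x hx => by
    have := hx.1
    have := hx.2
    gcongr
  have hXT : ∀ x ∈ Ioc 0 ρ, X x ≤ T x := fun x hx =>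
    h.slope_le hP hρ hk0 hkρ1 hν (by change X ρ ≤ T ρ; rw [hTρ]; exact le_max_left _ _) hx
  have hYT : ∀ x ∈ Ioc 0 ρ, Y x ≤ T x := fun x hx =>
    h.swap.slope_le hQ hρ hk0 hkρ1 hν (by change Y ρ ≤ T ρ; rw [hTρ]; exact le_max_right _ _) hx
  have hTν : ∀ x ∈ Ioc 0 ρ, ν ≤ T x := fun x hx => by
    have h1 := hkx x hx
    have := hx.1
    have h2 : 0 ≤ k * x ^ ν := by positivity
    simp only [hTd]
    rw [le_div_iff₀ (by linarith)]
    nlinarith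
  have hmem : ∀ x ∈ Ioc 0 ρ, x ∈ Icc 0 ρ := fun x hx => ⟨hx.1.le, hx.2⟩
  have hX0 : ∀ x ∈ Ioc 0 ρ, 0 ≤ X x := fun x hx => h.slope_nonneg hP (hmem x hx)
  have hY0 : ∀ x ∈ Ioc 0 ρ, 0 ≤ Y x := fun x hx => h.swap.slope_nonneg hQ (hmem x hx)
  have hS0 : ∀ x ∈ Ioc 0 ρ, 0 ≤ S x := fun x hx => h.log_source_nonneg hP (hmem x hx)
  have hV0 : ∀ x ∈ Ioc 0 ρ, 0 ≤ V x := fun x hx => h.swap.log_source_nonneg hQ (hmem x hx)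
  have hw0 : ∀ x ∈ Ioc 0 ρ, 0 < w x := fun x hx => by
    have h1 := h.φ_pos x (hmem x hx)
    have h2 := h.ψ_pos x (hmem x hx)
    have h3 := hx.1
    simp only [hwd]
    positivity
  have hmain := nonpos_of_hasDerivAt_nonpos hρ
    (fun x hx => hasDerivAt_energy (i := i) (j := j) (c := c) (s := s) (δ := δ) (μ := μ)
      (by rw [hi]; field_simp) (by rw [hj]; field_simp)
      (h.hasDerivAt_weight hx : HasDerivAt w _ x) (h.hasDerivAt_slope hx : HasDerivAt X _ x)
      (h.swap.hasDerivAt_slope hx : HasDerivAt Y _ x)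
      (h.hasDerivAt_log_source hx : HasDerivAt S _ x)
      (h.swap.hasDerivAt_log_source hx : HasDerivAt V _ x)
      (hasDerivAt_harmonic_slope hx.1 ((hkx x hx).trans_lt hkρ1) : HasDerivAt T _ x))
    (fun x hx => by
      have h1 := cubic_slope_inequality hν (hX0 x hx) (hY0 x hx) (hXT x hx) (hYT x hx) (hTν x hx)
      have h2 := mul_nonneg (hX0 x hx) (hY0 x hx)
      have h3 := mul_nonneg (hX0 x hx) (hS0 x hx)
      have h4 := mul_nonneg (hY0 x hx) (hV0 x hx)
      apply div_nonpos_of_nonpos_of_nonneg _ hx.1.le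
      apply mul_nonpos_of_nonneg_of_nonpos (hw0 x hx).le
      exact energy_rate_nonpos hc0.le hci hcj hab.le h1 h2 h3 h4)
    (by
      have tX : Tendsto X (𝓝[>] 0) (𝓝 0) := h.tendsto_slope hP hQ hν hs hδ hρ
      have tY : Tendsto Y (𝓝[>] 0) (𝓝 0) := h.swap.tendsto_slope hQ hP hν hs hμ hρ
      have tS : Tendsto S (𝓝[>] 0) (𝓝 0) := h.tendsto_log_source hρ
      have tV : Tendsto V (𝓝[>] 0) (𝓝 0) := h.swap.tendsto_log_source hρ
      have tw : Tendsto w (𝓝[>] 0) (𝓝 0) := h.tendsto_weight hν hρ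
      have tT : Tendsto T (𝓝[>] 0) (𝓝 ν) := by
        have h0 : Tendsto (fun x : ℝ => x) (𝓝[>] 0) (𝓝 0) :=
          tendsto_nhdsWithin_of_tendsto_nhds tendsto_id
        have h1 := h0.rpow_const (p := ν) (Or.inr hν.le)
        rw [Real.zero_rpow hν.ne'] at h1
        have h2 : Tendsto T (𝓝[>] 0) (𝓝 (ν / (1 - k * 0))) :=
          tendsto_const_nhds.div ((h1.const_mul k).const_sub 1) (by simp)
        simpa using h2
      have := tw.mul ((((((tX.mul tY).add (tS.const_mul i)).add (tV.const_mul j)).sub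
        (tY.const_mul ((ν + 1) * j))).sub (tX.const_mul ((ν + 1) * i))).add
        (((((tX.pow 2).add (tY.pow 2)).sub (tT.pow 2)).add (tT.const_mul ν)).const_mul c))
      simpa using this)
  have hρm : ρ ∈ Ioc 0 ρ := ⟨hρ, le_rfl⟩
  have hle := nonpos_of_mul_nonpos_right hmain (hw0 ρ hρm)
  have a1 : 2 * (ν + 1) ≤ X ρ := (le_max_right _ _).trans hXρ
  have a2 : 2 * (ν + 1) ≤ Y ρ := (le_max_right _ _).trans hYρ
  have a3 : 0 < X ρ ^ 2 + Y ρ ^ 2 - T ρ ^ 2 + ν * T ρ := by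
    rw [hTρ]
    exact sq_add_sq_sub_max_pos hν ht0
  have a5 := hS0 ρ hρm
  have a6 := hV0 ρ hρm
  exact absurd hle (not_le.2 (energy_pos hν hc0 hi0.le hj0.le hi1 hj1 a1 a2 a3 a5 a6))

end IsPosSol

/-! ### Energy of a single equation -/

namespace IsPosSol

variable {ν s δ μ P Q ρ : ℝ} {φ ψ M K : ℝ → ℝ}

lemma hasDerivAt_weight_sq (h : IsPosSol ν s δ μ P Q ρ φ ψ M K) {x : ℝ} (hx : x ∈ Ioc 0 ρ) :
    HasDerivAt (fun x => x ^ ν * φ x ^ 2)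
      (x ^ ν * φ x ^ 2 * (ν - 2 * (x ^ (-ν) * M x / φ x)) / x) x := by
  have hx0 := hx.1
  have hφ := h.φ_pos x ⟨hx0.le, hx.2⟩
  have h1 := (Real.hasDerivAt_rpow_const (x := x) (p := ν) (Or.inl hx0.ne')).mul
    ((h.hasDerivAt_φ x hx).pow 2)
  refine h1.congr_deriv ?_
  simp only [Pi.pow_apply, Nat.cast_ofNat]
  rw [Real.rpow_sub_one hx0.ne', neg_add', Real.rpow_sub_one hx0.ne']
  field_simp
  ring

/-- The Pohozaev energy of the first equation, the second component being part of the weight. -/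
noncomputable def scalarEnergy (ν s δ P : ℝ) (φ ψ M : ℝ → ℝ) (x : ℝ) : ℝ :=
  x ^ ν * φ x ^ 2 * ((x ^ (-ν) * M x / φ x) ^ 2 / 2
    + 1 / (s + 1) * (x * (P * (φ x ^ (s - 1) * ψ x ^ δ))) - ν / 2 * (x ^ (-ν) * M x / φ x))

lemma hasDerivAt_scalarEnergy (h : IsPosSol ν s δ μ P Q ρ φ ψ M K) (hs : 0 < s) {x : ℝ}
    (hx : x ∈ Ioc 0 ρ) :
    HasDerivAt (scalarEnergy ν s δ P φ ψ M)
      (x ^ ν * φ x ^ 2 * (x * (P * (φ x ^ (s - 1) * ψ x ^ δ))) *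
        ((ν + 1) / (s + 1) - ν / 2 - 1 / (s + 1) * (δ * (x ^ (-ν) * K x / ψ x))) / x) x := by
  have := (h.hasDerivAt_weight_sq hx).mul (((((h.hasDerivAt_slope hx).pow 2).div_const 2).add
    ((h.hasDerivAt_log_source hx).const_mul (1 / (s + 1)))).sub
    ((h.hasDerivAt_slope hx).const_mul (ν / 2)))
  refine this.congr_deriv ?_
  simp only [Pi.add_apply, Pi.sub_apply, Pi.pow_apply, Nat.cast_ofNat]
  have hi : 1 / (s + 1) * (s + 1) = 1 := by field_simp
  have hi2 : (ν + 1) / (s + 1) = (ν + 1) * (1 / (s + 1)) := by ring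
  rw [hi2]
  generalize x ^ (-ν) * M x / φ x = X
  generalize x ^ (-ν) * K x / ψ x = Y
  generalize x * (P * (φ x ^ (s - 1) * ψ x ^ δ)) = S
  generalize x ^ ν * φ x ^ 2 = w
  generalize 1 / (s + 1) = i at *
  linear_combination (-(w * S * X / x)) * hi

lemma tendsto_scalarEnergy (h : IsPosSol ν s δ μ P Q ρ φ ψ M K) (hP : 0 ≤ P) (hQ : 0 ≤ Q)
    (hν : 0 < ν) (hs : 0 < s) (hδ : 0 < δ) (hρ : 0 < ρ) :
    Tendsto (scalarEnergy ν s δ P φ ψ M) (𝓝[>] 0) (𝓝 0) := by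
  have tX := h.tendsto_slope hP hQ hν hs hδ hρ
  have tS := h.tendsto_log_source hρ
  have h0 : Tendsto (fun x : ℝ => x) (𝓝[>] 0) (𝓝 0) :=
    tendsto_nhdsWithin_of_tendsto_nhds tendsto_id
  have h1 := h0.rpow_const (p := ν) (Or.inr hν.le)
  rw [Real.zero_rpow hν.ne'] at h1
  have tw := h1.mul ((h.tendsto_φ hρ).pow 2)
  have := tw.mul ((((tX.pow 2).div_const 2).add (tS.const_mul (1 / (s + 1)))).sub
    (tX.const_mul (ν / 2)))
  simp only [zero_mul] at this
  exact this

/-- For critical or supercritical `s` the slopes of positive solutions stay bounded. -/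
lemma slope_le_of_supercritical (h : IsPosSol ν s δ μ P Q ρ φ ψ M K) (hP : 0 ≤ P) (hQ : 0 ≤ Q)
    (hν : 0 < ν) (hs : 0 < s) (hδ : 0 < δ) (hρ : 0 < ρ) (hcrit : (ν + 1) / (s + 1) ≤ ν / 2) :
    ρ ^ (-ν) * M ρ / φ ρ ≤ ν := by
  have hmain := nonpos_of_hasDerivAt_nonpos hρ (fun x hx => h.hasDerivAt_scalarEnergy hs hx)
    (fun x hx => by
      have hm : x ∈ Icc 0 ρ := ⟨hx.1.le, hx.2⟩
      have h1 := h.log_source_nonneg hP hm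
      have h2 := h.swap.slope_nonneg hQ hm
      have h3 := h.φ_pos x hm
      have h4 := hx.1
      apply div_nonpos_of_nonpos_of_nonneg _ h4.le
      apply mul_nonpos_of_nonneg_of_nonpos
      · exact mul_nonneg (by positivity) h1
      · have : 0 ≤ 1 / (s + 1) * (δ * (x ^ (-ν) * K x / ψ x)) := by
          have := mul_nonneg hδ.le h2
          positivity
        linarith)
    (h.tendsto_scalarEnergy hP hQ hν hs hδ hρ)
  have hm : ρ ∈ Icc 0 ρ := ⟨hρ.le, le_rfl⟩
  have h1 := h.log_source_nonneg hP hm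
  have h2 := h.slope_nonneg hP hm
  have h3 := h.φ_pos ρ hm
  have h5 := nonpos_of_mul_nonpos_right hmain (by positivity)
  have h6 : 0 ≤ 1 / (s + 1) * (ρ * (P * (φ ρ ^ (s - 1) * ψ ρ ^ δ))) :=
    mul_nonneg (by positivity) h1
  by_contra! hlt
  nlinarith

/-- On the whole half-line, the slope is at most that of the fundamental solution `x^{-ν}`. -/
lemma slope_le_of_global (h : ∀ ρ, IsPosSol ν s δ μ P Q ρ φ ψ M K) (hP : 0 ≤ P) (hν : 0 < ν)
    {x : ℝ} (hx : 0 < x) : x ^ (-ν) * M x / φ x ≤ ν := by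
  have hφ := (h x).φ_pos x ⟨hx.le, le_rfl⟩
  have hanti : ∀ y, x ≤ y → -(M x / ν * y ^ (-ν)) ≤ φ x - M x / ν * x ^ (-ν) := by
    intro y hxy
    have hd : ∀ z ∈ Icc x y, HasDerivAt (fun z => φ z - M x / ν * z ^ (-ν))
        (-(z ^ (-(ν + 1)) * (M z - M x))) z := fun z hz => by
      have hz0 := hx.trans_le hz.1
      have := ((h y).hasDerivAt_φ z ⟨hz0, hz.2⟩).sub
        ((Real.hasDerivAt_rpow_const (x := z) (p := -ν) (Or.inl hz0.ne')).const_mul (M x / ν))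
      refine this.congr_deriv ?_
      rw [show -(ν + 1) = -ν - 1 by ring]
      field_simp
      ring
    have h1 : AntitoneOn (fun z => φ z - M x / ν * z ^ (-ν)) (Icc x y) := by
      apply antitoneOn_Icc_of_hasDerivAt
      · exact fun z hz => (hd z hz).continuousAt.continuousWithinAt
      · exact fun z hz => hd z ⟨hz.1.le, hz.2.le⟩
      · intro z hz
        have hz0 := hx.trans hz.1
        have := (h y).monotoneOn_M hP ⟨hx.le, hxy⟩ ⟨hz0.le, hz.2.le⟩ hz.1.le
        have := mul_nonneg (Real.rpow_pos_of_pos hz0 (-(ν + 1))).le (sub_nonneg.2 this)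
        linarith
    have h2 := h1 ⟨le_rfl, hxy⟩ ⟨hxy, le_rfl⟩ hxy
    have h3 := (h y).φ_pos y ⟨hx.le.trans hxy, le_rfl⟩
    simp only at h2
    linarith
  have hlim : Tendsto (fun y : ℝ => -(M x / ν * y ^ (-ν))) atTop (𝓝 0) := by
    simpa using ((tendsto_rpow_neg_atTop hν).const_mul (M x / ν)).neg
  have h1 := le_of_tendsto hlim ((eventually_ge_atTop x).mono hanti)
  rw [div_le_iff₀ hφ]
  have h2 : ν * (M x / ν * x ^ (-ν)) = x ^ (-ν) * M x := by field_simp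
  nlinarith

/-- For subcritical `s`, a positive solution on the half-line cannot have a constant second
component: the energy would be positive and increasing, while it tends to `0` at infinity. -/
theorem not_global_scalar (h : ∀ ρ, IsPosSol ν s δ μ 1 0 ρ φ ψ M K) (hν : 0 < ν) (hs : 0 < s)
    (hδ : 0 < δ) (hμ : 0 < μ) (hcrit : ν / 2 < (ν + 1) / (s + 1)) : False := by
  have hP : (0 : ℝ) ≤ 1 := zero_le_one
  have hQ : (0 : ℝ) ≤ 0 := le_rfl
  have hm : ∀ x : ℝ, 0 < x → x ∈ Icc 0 x := fun x hx => ⟨hx.le, le_rfl⟩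
  have hK : ∀ x, 0 < x → K x = 0 := fun x hx =>
    le_antisymm (by simpa using (h x).swap.M_le hQ hP hν hs hμ (hm x hx))
      ((h x).swap.M_nonneg hQ (hm x hx))
  have hψ : ∀ x, 0 < x → ψ x = 1 := fun x hx => by
    apply le_antisymm ((h x).swap.φ_le_one hQ (hm x hx))
    have := (h x).swap.φ_sub_le hQ hP hν hs hμ le_rfl hx.le le_rfl
    rw [(h x).ψ_zero] at this
    simpa using this
  have hX : ∀ x, 0 < x → x ^ (-ν) * M x / φ x ≤ ν := fun x hx => slope_le_of_global h hP hν hx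
  set A := (ν + 1) * ν with hA
  have hA0 : 0 < A := by positivity
  have hSA : ∀ x, 0 < x → x * φ x ^ (s - 1) ≤ A := fun x hx => by
    have hφ := (h x).φ_pos x (hm x hx)
    have h1 := (h x).source_mul_le_M hP hQ hν hs hδ (hm x hx)
    have h2 := hX x hx
    rw [div_le_iff₀ hφ, Real.rpow_neg hx.le] at h2
    rw [hψ x hx, Real.one_rpow, Real.rpow_add_one hx.ne'] at h1
    have hxν := Real.rpow_pos_of_pos hx ν
    rw [inv_mul_le_iff₀ hxν] at h2
    rw [Real.rpow_sub_one hφ.ne', hA, ← mul_div_assoc, div_le_iff₀ hφ]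
    have h3 := h1.trans h2
    rw [one_mul, mul_one, ← mul_div_assoc, div_le_iff₀ (by positivity)] at h3
    have h4 : x ^ ν * (x * φ x ^ s) ≤ x ^ ν * ((ν + 1) * ν * φ x) := by linarith
    exact le_of_mul_le_mul_left h4 hxν
  -- for `s ≤ 1` one has `S ≥ x`, which is unbounded
  rcases le_or_gt s 1 with hs1 | hs1
  · have hx : 0 < A + 1 := by positivity
    have hφ := (h _).φ_pos _ (hm _ hx)
    have h1 : 1 ≤ φ (A + 1) ^ (s - 1) :=
      Real.one_le_rpow_of_pos_of_le_one_of_nonpos hφ ((h _).φ_le_one hP (hm _ hx)) (by linarith)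
    have h2 := hSA _ hx
    nlinarith
  -- for `s > 1` the bound on `S` gives the decay `φ ≤ (A / x)^{1/(s-1)}`, and `q > 0` below is
  -- subcriticality
  · set En := scalarEnergy ν s δ 1 φ ψ M with hEn
    have hd : ∀ x, 0 < x → HasDerivAt En _ x := fun x hx =>
      (h x).hasDerivAt_scalarEnergy hs ⟨hx, le_rfl⟩
    have hpos : ∀ x, 0 < x → 0 < x ^ ν * φ x ^ 2 * (x * (1 * (φ x ^ (s - 1) * ψ x ^ δ))) *
        ((ν + 1) / (s + 1) - ν / 2 - 1 / (s + 1) * (δ * (x ^ (-ν) * K x / ψ x))) / x := by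
      intro x hx
      have hφ := (h x).φ_pos x (hm x hx)
      have hψ' := (h x).ψ_pos x (hm x hx)
      rw [hK x hx]
      simp only [mul_zero, zero_div, sub_zero]
      have := sub_pos.2 hcrit
      positivity
    have hmono : StrictMonoOn En (Ioi 0) := by
      apply strictMonoOn_of_deriv_pos (convex_Ioi 0)
      · exact fun x hx => (hd x hx).continuousAt.continuousWithinAt
      · intro x hx
        rw [interior_Ioi] at hx
        rw [(hd x hx).deriv]
        exact hpos x hx
    have hhalf : 0 ≤ En (1 / 2) := by
      apply le_of_tendsto ((h 1).tendsto_scalarEnergy hP hQ hν hs hδ one_pos)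
      filter_upwards [Ioo_mem_nhdsGT (show (0 : ℝ) < 1 / 2 by norm_num)] with y hy
      exact (hmono (mem_Ioi.2 hy.1) (mem_Ioi.2 (by norm_num)) hy.2).le
    have hone : 0 < En 1 := hhalf.trans_lt
      (hmono (mem_Ioi.2 (by norm_num)) (mem_Ioi.2 one_pos) (by norm_num))
    have hs0 : 0 < s - 1 := by linarith
    set q := 2 / (s - 1) - ν with hq
    have hq0 : 0 < q := by
      rw [div_lt_div_iff₀ two_pos (by positivity)] at hcrit
      rw [hq, sub_pos, lt_div_iff₀ hs0]
      linarith
    have hbound : ∀ x, 1 ≤ x → En 1 ≤ (ν ^ 2 / 2 + A) * A ^ (2 / (s - 1)) * x ^ (-q) := by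
      intro x hx1
      have hx : 0 < x := by linarith
      have hφ := (h x).φ_pos x (hm x hx)
      have h1 : En 1 ≤ En x := hmono.monotoneOn (mem_Ioi.2 one_pos) (mem_Ioi.2 hx) hx1
      have h2 : φ x ^ 2 ≤ (A / x) ^ (2 / (s - 1)) := by
        have h3 : φ x ^ (s - 1) ≤ A / x := by
          rw [le_div_iff₀ hx]; linarith [hSA x hx]
        have h4 := Real.rpow_le_rpow (by positivity) h3 (show 0 ≤ 2 / (s - 1) by positivity)
        rw [← Real.rpow_mul hφ.le, mul_div_cancel₀ _ hs0.ne'] at h4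
        exact_mod_cast h4
      have hXn := (h x).slope_nonneg hP (hm x hx)
      have hXx := hX x hx
      have hS : x * (1 * (φ x ^ (s - 1) * ψ x ^ δ)) ≤ A := by
        rw [hψ x hx, Real.one_rpow, one_mul, mul_one]; exact hSA x hx
      have hSn := (h x).log_source_nonneg hP (hm x hx)
      have hi1 : 1 / (s + 1) ≤ 1 := by rw [div_le_one (by positivity)]; linarith
      have hi0 : 0 < 1 / (s + 1) := by positivity
      have h5 : (x ^ (-ν) * M x / φ x) ^ 2 / 2
          + 1 / (s + 1) * (x * (1 * (φ x ^ (s - 1) * ψ x ^ δ))) - ν / 2 * (x ^ (-ν) * M x / φ x)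
          ≤ ν ^ 2 / 2 + A := by
        generalize x * (1 * (φ x ^ (s - 1) * ψ x ^ δ)) = S at *
        generalize x ^ (-ν) * M x / φ x = X at *
        nlinarith
      calc En 1 ≤ En x := h1
        _ ≤ x ^ ν * φ x ^ 2 * (ν ^ 2 / 2 + A) := by
            rw [hEn]; unfold scalarEnergy
            gcongr
        _ ≤ x ^ ν * (A / x) ^ (2 / (s - 1)) * (ν ^ 2 / 2 + A) := by gcongr
        _ = _ := by
            rw [Real.div_rpow hA0.le hx.le, hq, neg_sub, Real.rpow_sub hx]
            ring
    have hlim : Tendsto (fun x : ℝ => (ν ^ 2 / 2 + A) * A ^ (2 / (s - 1)) * x ^ (-q)) atTop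
        (𝓝 0) := by
      simpa using (tendsto_rpow_neg_atTop hq0).const_mul ((ν ^ 2 / 2 + A) * A ^ (2 / (s - 1)))
    have := ge_of_tendsto hlim ((eventually_ge_atTop 1).mono hbound)
    linarith

end IsPosSol

/-! ### The clipped system and continuation of positive solutions -/

/-- Projection of a real number to `[η, 1]`. -/
noncomputable def clip (η x : ℝ) : ℝ := max η (min x 1)

/-- The nonlinearity of the system with coefficients `1 - t` and `t`, both arguments being
projected to `[η, 1]`, which makes it bounded and Lipschitz. -/
noncomputable def clippedSource (s δ μ η t : ℝ) (e : ℝ × ℝ) : ℝ × ℝ :=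
  ((1 - t) * (clip η e.1 ^ s * clip η e.2 ^ δ), t * (clip η e.1 ^ μ * clip η e.2 ^ s))

lemma clip_mem {η : ℝ} (hη : η ≤ 1) (x : ℝ) : clip η x ∈ Icc η 1 :=
  ⟨le_max_left _ _, max_le hη (min_le_right _ _)⟩

lemma clip_eq_self {η x : ℝ} (h : x ∈ Icc η 1) : clip η x = x := by
  rw [clip, min_eq_left h.2, max_eq_right h.1]

lemma exists_lipschitzWith_clippedSource {s δ μ η t : ℝ} (hη : 0 < η) (hη1 : η ≤ 1) :
    ∃ C, LipschitzWith C (clippedSource s δ μ η t) := by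
  have hclip : LipschitzWith 1 (clip η) := (LipschitzWith.id.min_const 1).const_max η
  have hpair : LipschitzWith 1 (fun e : ℝ × ℝ => (clip η e.1, clip η e.2)) := by
    simpa using (hclip.comp LipschitzWith.prod_fst).prodMk (hclip.comp LipschitzWith.prod_snd)
  obtain ⟨C, hC⟩ := ContDiffOn.exists_lipschitzOnWith (n := 1)
    (f := fun e : ℝ × ℝ => ((1 - t) * (e.1 ^ s * e.2 ^ δ), t * (e.1 ^ μ * e.2 ^ s)))
    (s := Icc η 1 ×ˢ Icc η 1)
    (by
      have h1 : ∀ e ∈ Icc η 1 ×ˢ Icc η 1, e.1 ≠ 0 := fun e he => (hη.trans_le he.1.1).ne'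
      have h2 : ∀ e ∈ Icc η 1 ×ˢ Icc η 1, e.2 ≠ 0 := fun e he => (hη.trans_le he.2.1).ne'
      have c1 : ∀ p : ℝ, ContDiffOn ℝ 1 (fun e : ℝ × ℝ => e.1 ^ p) (Icc η 1 ×ˢ Icc η 1) :=
        fun p => contDiffOn_fst.rpow_const_of_ne h1
      have c2 : ∀ p : ℝ, ContDiffOn ℝ 1 (fun e : ℝ × ℝ => e.2 ^ p) (Icc η 1 ×ˢ Icc η 1) :=
        fun p => contDiffOn_snd.rpow_const_of_ne h2
      exact (contDiffOn_const.mul ((c1 s).mul (c2 δ))).prodMk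
        (contDiffOn_const.mul ((c1 μ).mul (c2 s))))
    one_ne_zero ((convex_Icc _ _).prod (convex_Icc _ _)) (isCompact_Icc.prod isCompact_Icc)
  refine ⟨C, ?_⟩
  have := hC.comp hpair.lipschitzOnWith (s := univ)
    (fun e _ => ⟨clip_mem hη1 e.1, clip_mem hη1 e.2⟩)
  rw [mul_one, lipschitzOnWith_univ] at this
  exact this

lemma rpow_mul_rpow_mem {a b p q : ℝ} (ha : a ∈ Icc (0 : ℝ) 1) (hb : b ∈ Icc (0 : ℝ) 1)
    (hp : 0 ≤ p) (hq : 0 ≤ q) : a ^ p * b ^ q ∈ Icc (0 : ℝ) 1 :=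
  unitInterval.mul_mem ⟨Real.rpow_nonneg ha.1 _, Real.rpow_le_one ha.1 ha.2 hp⟩
    ⟨Real.rpow_nonneg hb.1 _, Real.rpow_le_one hb.1 hb.2 hq⟩

section Clipped

variable {ν s δ μ η t : ℝ}

lemma clip_mem_unit (hη : 0 < η) (hη1 : η ≤ 1) (x : ℝ) : clip η x ∈ Icc (0 : ℝ) 1 :=
  ⟨hη.le.trans (clip_mem hη1 x).1, (clip_mem hη1 x).2⟩

lemma clippedSource_nonneg (hη : 0 < η) (hη1 : η ≤ 1) (hs : 0 < s) (hδ : 0 < δ) (hμ : 0 < μ)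
    (ht : t ∈ Icc (0 : ℝ) 1) (e : ℝ × ℝ) : 0 ≤ clippedSource s δ μ η t e := by
  have h1 := (rpow_mul_rpow_mem (clip_mem_unit hη hη1 e.1) (clip_mem_unit hη hη1 e.2)
    hs.le hδ.le).1
  have h2 := (rpow_mul_rpow_mem (clip_mem_unit hη hη1 e.1) (clip_mem_unit hη hη1 e.2)
    hμ.le hs.le).1
  exact ⟨mul_nonneg (sub_nonneg.2 ht.2) h1, mul_nonneg ht.1 h2⟩

lemma norm_clippedSource_le (hη : 0 < η) (hη1 : η ≤ 1) (hs : 0 < s) (hδ : 0 < δ) (hμ : 0 < μ)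
    (ht : t ∈ Icc (0 : ℝ) 1) (e : ℝ × ℝ) : ‖clippedSource s δ μ η t e‖ ≤ 1 := by
  have h0 := clippedSource_nonneg hη hη1 hs hδ hμ ht e
  have h1 := (rpow_mul_rpow_mem (clip_mem_unit hη hη1 e.1) (clip_mem_unit hη hη1 e.2)
    hs.le hδ.le).2
  have h2 := (rpow_mul_rpow_mem (clip_mem_unit hη hη1 e.1) (clip_mem_unit hη hη1 e.2)
    hμ.le hs.le).2
  rw [Prod.norm_def, max_le_iff, Real.norm_of_nonneg h0.1, Real.norm_of_nonneg h0.2]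
  have h3 := (rpow_mul_rpow_mem (clip_mem_unit hη hη1 e.1) (clip_mem_unit hη hη1 e.2)
    hs.le hδ.le).1
  have h4 := (rpow_mul_rpow_mem (clip_mem_unit hη hη1 e.1) (clip_mem_unit hη hη1 e.2)
    hμ.le hs.le).1
  exact ⟨mul_le_one₀ (by linarith [ht.1]) h3 h1, mul_le_one₀ ht.2 h4 h2⟩

lemma norm_clippedSource_sub_le (hη : 0 < η) (hη1 : η ≤ 1) (hs : 0 < s) (hδ : 0 < δ)
    (hμ : 0 < μ) (t' : ℝ) (e : ℝ × ℝ) :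
    ‖clippedSource s δ μ η t e - clippedSource s δ μ η t' e‖ ≤ |t' - t| := by
  have h1 := rpow_mul_rpow_mem (clip_mem_unit hη hη1 e.1) (clip_mem_unit hη hη1 e.2) hs.le hδ.le
  have h2 := rpow_mul_rpow_mem (clip_mem_unit hη hη1 e.1) (clip_mem_unit hη hη1 e.2) hμ.le hs.le
  rw [Prod.norm_def, max_le_iff]
  simp only [clippedSource, Prod.fst_sub, Prod.snd_sub, ← sub_mul, Real.norm_eq_abs, abs_mul,
    sub_sub_sub_cancel_left, abs_of_nonneg h1.1, abs_of_nonneg h2.1]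
  rw [abs_sub_comm t t']
  exact ⟨mul_le_of_le_one_right (abs_nonneg _) h1.2, mul_le_of_le_one_right (abs_nonneg _) h2.2⟩

/-- Solutions on the half-line of the system with clipped nonlinearity. -/
def IsClippedSol (ν s δ μ η t : ℝ) (y : ℝ → ℝ × ℝ) : Prop :=
  Continuous y ∧ ∀ ρ, SolvesRadial ν (clippedSource s δ μ η t) (1, 1) ρ y

/-- The pair of fluxes of a solution of the clipped system. -/
noncomputable def clippedFlux (ν s δ μ η t : ℝ) (y : ℝ → ℝ × ℝ) (x : ℝ) : ℝ × ℝ :=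
  ∫ w in (0 : ℝ)..x, w ^ ν • clippedSource s δ μ η t (y w)

lemma continuous_clippedSource (hη : 0 < η) (hη1 : η ≤ 1) :
    Continuous (clippedSource s δ μ η t) :=
  (exists_lipschitzWith_clippedSource hη hη1).choose_spec.continuous

lemma exists_isClippedSol (hν : 0 < ν) (hη : 0 < η) (hη1 : η ≤ 1) (hs : 0 < s) (hδ : 0 < δ)
    (hμ : 0 < μ) (ht : t ∈ Icc (0 : ℝ) 1) : ∃ y, IsClippedSol ν s δ μ η t y := by
  obtain ⟨C, hC⟩ := exists_lipschitzWith_clippedSource (s := s) (δ := δ) (μ := μ) (t := t) hη hη1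
  exact exists_solvesRadial hν hC (norm_clippedSource_le hη hη1 hs hδ hμ ht) (1, 1)

namespace IsClippedSol

variable {y : ℝ → ℝ × ℝ}

lemma hasDerivAt_flux (h : IsClippedSol ν s δ μ η t y) (hν : 0 < ν) (hη : 0 < η) (hη1 : η ≤ 1)
    (x : ℝ) : HasDerivAt (clippedFlux ν s δ μ η t y)
      (x ^ ν • clippedSource s δ μ η t (y x)) x :=
  _root_.hasDerivAt_flux hν ((continuous_clippedSource hη hη1).comp h.1) x

lemma hasDerivAt (h : IsClippedSol ν s δ μ η t y) (hν : 0 < ν) (hη : 0 < η) (hη1 : η ≤ 1)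
    {x : ℝ} (hx : 0 < x) :
    HasDerivAt y (-(x ^ (-(ν + 1)) • clippedFlux ν s δ μ η t y x)) x :=
  SolvesRadial.hasDerivAt hν (continuous_clippedSource hη hη1) h.1 h.2 hx

lemma eq_zero (h : IsClippedSol ν s δ μ η t y) : y 0 = (1, 1) := (h.2 0).eq_zero le_rfl

lemma flux_zero : clippedFlux ν s δ μ η t y 0 = 0 := by simp [clippedFlux]

lemma flux_nonneg (h : IsClippedSol ν s δ μ η t y) (hν : 0 < ν) (hη : 0 < η) (hη1 : η ≤ 1)
    (hs : 0 < s) (hδ : 0 < δ) (hμ : 0 < μ) (ht : t ∈ Icc (0 : ℝ) 1) {x : ℝ} (hx : 0 ≤ x) :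
    0 ≤ clippedFlux ν s δ μ η t y x := by
  have hd := h.hasDerivAt_flux hν hη hη1
  have hn : ∀ z ∈ Ioo 0 x, 0 ≤ z ^ ν • clippedSource s δ μ η t (y z) := fun z hz =>
    smul_nonneg (Real.rpow_nonneg hz.1.le _) (clippedSource_nonneg hη hη1 hs hδ hμ ht _)
  have h1 := monotoneOn_Icc_of_hasDerivAt (a := 0) (b := x)
    (fun z _ => (hasFDerivAt_fst.comp_hasDerivAt z (hd z)).continuousAt.continuousWithinAt)
    (fun z _ => hasFDerivAt_fst.comp_hasDerivAt z (hd z)) (fun z hz => (hn z hz).1)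
  have h2 := monotoneOn_Icc_of_hasDerivAt (a := 0) (b := x)
    (fun z _ => (hasFDerivAt_snd.comp_hasDerivAt z (hd z)).continuousAt.continuousWithinAt)
    (fun z _ => hasFDerivAt_snd.comp_hasDerivAt z (hd z)) (fun z hz => (hn z hz).2)
  have e1 := h1 ⟨le_rfl, hx⟩ ⟨hx, le_rfl⟩ hx
  have e2 := h2 ⟨le_rfl, hx⟩ ⟨hx, le_rfl⟩ hx
  simp only [Function.comp, flux_zero] at e1 e2
  exact ⟨e1, e2⟩

lemma antitoneOn (h : IsClippedSol ν s δ μ η t y) (hν : 0 < ν) (hη : 0 < η) (hη1 : η ≤ 1)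
    (hs : 0 < s) (hδ : 0 < δ) (hμ : 0 < μ) (ht : t ∈ Icc (0 : ℝ) 1) {a b : ℝ} (ha : 0 ≤ a)
    (hab : a ≤ b) : y b ≤ y a := by
  have hd : ∀ z ∈ Ioo a b, _ := fun z hz => h.hasDerivAt hν hη hη1 (ha.trans_lt hz.1)
  have hn : ∀ z ∈ Ioo a b, -(z ^ (-(ν + 1)) • clippedFlux ν s δ μ η t y z) ≤ 0 := fun z hz => by
    have hz0 := ha.trans hz.1.le
    exact neg_nonpos.2 (smul_nonneg (Real.rpow_nonneg hz0 _)
      (h.flux_nonneg hν hη hη1 hs hδ hμ ht hz0))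
  have h1 := antitoneOn_Icc_of_hasDerivAt (f := Prod.fst ∘ y) (a := a) (b := b)
    (continuous_fst.comp h.1).continuousOn
    (fun z hz => hasFDerivAt_fst.comp_hasDerivAt z (hd z hz)) (fun z hz => (hn z hz).1)
  have h2 := antitoneOn_Icc_of_hasDerivAt (f := Prod.snd ∘ y) (a := a) (b := b)
    (continuous_snd.comp h.1).continuousOn
    (fun z hz => hasFDerivAt_snd.comp_hasDerivAt z (hd z hz)) (fun z hz => (hn z hz).2)
  exact ⟨h1 ⟨le_rfl, hab⟩ ⟨hab, le_rfl⟩ hab, h2 ⟨le_rfl, hab⟩ ⟨hab, le_rfl⟩ hab⟩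

lemma le_one (h : IsClippedSol ν s δ μ η t y) (hν : 0 < ν) (hη : 0 < η) (hη1 : η ≤ 1)
    (hs : 0 < s) (hδ : 0 < δ) (hμ : 0 < μ) (ht : t ∈ Icc (0 : ℝ) 1) {x : ℝ} (hx : 0 ≤ x) :
    (y x).1 ≤ 1 ∧ (y x).2 ≤ 1 := by
  have := h.antitoneOn hν hη hη1 hs hδ hμ ht le_rfl hx
  rw [h.eq_zero] at this
  exact this

lemma isPosSol (h : IsClippedSol ν s δ μ η t y) (hν : 0 < ν) (hη : 0 < η) (hη1 : η ≤ 1)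
    (hs : 0 < s) (hδ : 0 < δ) (hμ : 0 < μ) (ht : t ∈ Icc (0 : ℝ) 1) {ρ : ℝ}
    (hy : ∀ x ∈ Icc 0 ρ, η ≤ (y x).1 ∧ η ≤ (y x).2) :
    IsPosSol ν s δ μ (1 - t) t ρ (fun x => (y x).1) (fun x => (y x).2)
      (fun x => (clippedFlux ν s δ μ η t y x).1) (fun x => (clippedFlux ν s δ μ η t y x).2) := by
  have hfc : Continuous (clippedFlux ν s δ μ η t y) :=
    continuous_iff_continuousAt.2 fun x => (h.hasDerivAt_flux hν hη hη1 x).continuousAt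
  have hsrc : ∀ x ∈ Ioc 0 ρ, clippedSource s δ μ η t (y x) =
      ((1 - t) * ((y x).1 ^ s * (y x).2 ^ δ), t * ((y x).1 ^ μ * (y x).2 ^ s)) := by
    intro x hx
    have h1 := hy x ⟨hx.1.le, hx.2⟩
    have h2 := h.le_one hν hη hη1 hs hδ hμ ht hx.1.le
    rw [clippedSource, clip_eq_self ⟨h1.1, h2.1⟩, clip_eq_self ⟨h1.2, h2.2⟩]
  constructor
  · exact (continuous_fst.comp h.1).continuousOn
  · exact (continuous_snd.comp h.1).continuousOn
  · exact (continuous_fst.comp hfc).continuousOn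
  · exact (continuous_snd.comp hfc).continuousOn
  · rw [h.eq_zero]
  · rw [h.eq_zero]
  · rw [flux_zero]; rfl
  · rw [flux_zero]; rfl
  · exact fun x hx => hη.trans_le (hy x hx).1
  · exact fun x hx => hη.trans_le (hy x hx).2
  · intro x hx
    have := hasFDerivAt_fst.comp_hasDerivAt x (h.hasDerivAt hν hη hη1 hx.1)
    exact this
  · intro x hx
    have := hasFDerivAt_snd.comp_hasDerivAt x (h.hasDerivAt hν hη hη1 hx.1)
    exact this
  · intro x hx
    have := hasFDerivAt_fst.comp_hasDerivAt x (h.hasDerivAt_flux hν hη hη1 x)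
    rw [hsrc x hx] at this
    exact this
  · intro x hx
    have := hasFDerivAt_snd.comp_hasDerivAt x (h.hasDerivAt_flux hν hη hη1 x)
    rw [hsrc x hx] at this
    exact this

lemma clippedSource_eq (h : IsClippedSol ν s δ μ η t y) (hν : 0 < ν) (hη : 0 < η) (hη1 : η ≤ 1)
    (hs : 0 < s) (hδ : 0 < δ) (hμ : 0 < μ) (ht : t ∈ Icc (0 : ℝ) 1) {ρ : ℝ}
    (hy : ∀ x ∈ Icc 0 ρ, η ≤ (y x).1 ∧ η ≤ (y x).2) {η' : ℝ} (hη' : η' ≤ η) {x : ℝ}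
    (hx : x ∈ Icc 0 ρ) :
    clippedSource s δ μ η' t (y x) = clippedSource s δ μ η t (y x) := by
  have h1 := hy x hx
  have h2 := h.le_one hν hη hη1 hs hδ hμ ht hx.1
  rw [clippedSource, clippedSource, clip_eq_self ⟨h1.1, h2.1⟩, clip_eq_self ⟨h1.2, h2.2⟩,
    clip_eq_self ⟨hη'.trans h1.1, h2.1⟩, clip_eq_self ⟨hη'.trans h1.2, h2.2⟩]

/-- As long as a solution stays above its clipping level, lowering the level does not change it. -/
lemma eqOn_of_le (h : IsClippedSol ν s δ μ η t y) (hν : 0 < ν) (hη : 0 < η) (hη1 : η ≤ 1)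
    (hs : 0 < s) (hδ : 0 < δ) (hμ : 0 < μ) (ht : t ∈ Icc (0 : ℝ) 1) {ρ : ℝ}
    (hy : ∀ x ∈ Icc 0 ρ, η ≤ (y x).1 ∧ η ≤ (y x).2) {η' : ℝ} (hη'0 : 0 < η') (hη' : η' ≤ η)
    {y' : ℝ → ℝ × ℝ} (h' : IsClippedSol ν s δ μ η' t y') {x : ℝ} (hx : x ∈ Icc 0 ρ) :
    y' x = y x ∧ clippedFlux ν s δ μ η' t y' x = clippedFlux ν s δ μ η t y x := by
  have key : ∀ z ∈ Icc 0 ρ, y' z = y z := by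
    intro z hz
    obtain ⟨C, hC⟩ := exists_lipschitzWith_clippedSource (s := s) (δ := δ) (μ := μ) (t := t)
      hη'0 (hη'.trans hη1)
    have := SolvesRadial.norm_sub_le hν hC (continuous_clippedSource hη hη1)
      (hz.1.trans hz.2) h'.1 h.1 (h'.2 ρ) (h.2 ρ) (ε := 0) (fun x hx => by
        rw [h.clippedSource_eq hν hη hη1 hs hδ hμ ht hy hη' hx]; simp) z hz
    rw [← sub_eq_zero, ← norm_le_zero_iff]
    simpa using this
  refine ⟨key x hx, ?_⟩
  apply intervalIntegral.integral_congr
  intro z hz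
  rw [uIcc_of_le hx.1] at hz
  have hz' : z ∈ Icc 0 ρ := ⟨hz.1, hz.2.trans hx.2⟩
  simp only
  rw [key z hz', h.clippedSource_eq hν hη hη1 hs hδ hμ ht hy hη' hz']

/-- Values and fluxes of the clipped solutions depend on `t` in a Lipschitz way. -/
lemma exists_lipschitz_dependence (h : IsClippedSol ν s δ μ η t y) (hν : 0 < ν) (hη : 0 < η)
    (hη1 : η ≤ 1) (hs : 0 < s) (hδ : 0 < δ) (hμ : 0 < μ) {ρ : ℝ} (hρ : 0 ≤ ρ) :
    ∃ L, ∀ t' : ℝ, ∀ y', IsClippedSol ν s δ μ η t' y' →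
      (∀ x ∈ Icc 0 ρ, ‖y' x - y x‖ ≤ L * |t' - t|) ∧
      ‖clippedFlux ν s δ μ η t' y' ρ - clippedFlux ν s δ μ η t y ρ‖ ≤ L * |t' - t| := by
  obtain ⟨C, hC⟩ := exists_lipschitzWith_clippedSource (s := s) (δ := δ) (μ := μ) (t := t)
      hη hη1
  set D := 2 * ρ * Real.exp ((2 * C + 1) * ρ) with hD
  have hD0 : 0 ≤ D := by positivity
  have hC0 : (0 : ℝ) ≤ C := C.2
  refine ⟨max D (ρ ^ ν * (1 + C * D) * |ρ - 0|), fun t' y' h' => ?_⟩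
  have hcs : ∀ τ, Continuous (clippedSource s δ μ η τ) := fun τ => continuous_clippedSource hη hη1
  have h1 : ∀ x ∈ Icc 0 ρ, ‖y' x - y x‖ ≤ D * |t' - t| := by
    intro x hx
    have := SolvesRadial.norm_sub_le hν hC (hcs t')
      hρ h.1 h'.1 (h.2 ρ) (h'.2 ρ) (ε := |t' - t|)
      (fun x hx => norm_clippedSource_sub_le hη hη1 hs hδ hμ t' _) x hx
    rw [norm_sub_rev, hD]
    linarith
  refine ⟨fun x hx => (h1 x hx).trans (by gcongr; exact le_max_left _ _), ?_⟩
  have hc : ∀ τ, ∀ z : ℝ → ℝ × ℝ, Continuous z →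
      Continuous fun w : ℝ => w ^ ν • clippedSource s δ μ η τ (z w) := fun τ z hz =>
    (Real.continuous_rpow_const hν.le).smul ((hcs τ).comp hz)
  rw [clippedFlux, clippedFlux, ← intervalIntegral.integral_sub
    ((hc t' y' h'.1).intervalIntegrable _ _) ((hc t y h.1).intervalIntegrable _ _)]
  have h2 : ∀ w ∈ uIoc 0 ρ, ‖w ^ ν • clippedSource s δ μ η t' (y' w)
      - w ^ ν • clippedSource s δ μ η t (y w)‖ ≤ ρ ^ ν * ((1 + C * D) * |t' - t|) := by
    intro w hw
    rw [uIoc_of_le hρ] at hw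
    rw [← smul_sub, norm_smul, Real.norm_of_nonneg (Real.rpow_nonneg hw.1.le _)]
    have hw0 := hw.1
    have e1 : ‖clippedSource s δ μ η t' (y' w) - clippedSource s δ μ η t (y' w)‖ ≤ |t' - t| := by
      rw [norm_sub_rev]
      exact norm_clippedSource_sub_le hη hη1 hs hδ hμ t' _
    have e2 : ‖clippedSource s δ μ η t (y' w) - clippedSource s δ μ η t (y w)‖
        ≤ C * (D * |t' - t|) :=
      (hC.norm_sub_le _ _).trans (by gcongr; exact h1 w ⟨hw.1.le, hw.2⟩)
    have e3 := norm_sub_le_norm_sub_add_norm_sub (clippedSource s δ μ η t' (y' w))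
      (clippedSource s δ μ η t (y' w)) (clippedSource s δ μ η t (y w))
    gcongr
    · exact hw.2
    · linarith
  calc _ ≤ ρ ^ ν * ((1 + C * D) * |t' - t|) * |ρ - 0| :=
        intervalIntegral.norm_integral_le_of_norm_le_const h2
    _ = ρ ^ ν * (1 + C * D) * |ρ - 0| * |t' - t| := by ring
    _ ≤ _ := by gcongr; exact le_max_right _ _

end IsClippedSol

/-- The solution with parameter `t` stays positive at least up to some `ρ` at which the pair of
values and the pair of fluxes satisfy the condition `O ρ`. -/
def Reaches (ν s δ μ : ℝ) (O : ℝ → Set ((ℝ × ℝ) × (ℝ × ℝ))) (t : ℝ) : Prop :=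
  ∃ η ∈ Ioc (0 : ℝ) 1, ∃ ρ > 0, ∃ y, IsClippedSol ν s δ μ η t y ∧
    (∀ x ∈ Icc 0 ρ, η ≤ (y x).1 ∧ η ≤ (y x).2) ∧ (y ρ, clippedFlux ν s δ μ η t y ρ) ∈ O ρ

lemma isOpen_reaches (hν : 0 < ν) (hs : 0 < s) (hδ : 0 < δ) (hμ : 0 < μ)
    {O : ℝ → Set ((ℝ × ℝ) × (ℝ × ℝ))} (hO : ∀ ρ > 0, IsOpen (O ρ)) :
    IsOpen {t : unitInterval | Reaches ν s δ μ O t} := by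
  rw [isOpen_iff_mem_nhds]
  rintro t₀ ⟨η, hη, ρ, hρ, y, hy, hyη, hyO⟩
  have hη2 : 0 < η / 2 := half_pos hη.1
  have hη21 : η / 2 ≤ 1 := by linarith [hη.2]
  -- with the level lowered to `η / 2`, the bound `η ≤ y` is an open condition
  choose z hz using fun t : unitInterval =>
    exists_isClippedSol (t := (t : ℝ)) hν hη2 hη21 hs hδ hμ t.2
  have heq := fun x (hx : x ∈ Icc 0 ρ) => hy.eqOn_of_le hν hη.1 hη.2 hs hδ hμ t₀.2 hyη hη2
    (half_le_self hη.1.le) (hz t₀) hx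
  obtain ⟨L, hL⟩ := (hz t₀).exists_lipschitz_dependence hν hη2 hη21 hs hδ hμ hρ.le
  have hlim : Tendsto (fun t : unitInterval => L * |(t : ℝ) - t₀|) (𝓝 t₀) (𝓝 0) := by
    have : Continuous (fun t : unitInterval => L * |(t : ℝ) - t₀|) := by fun_prop
    simpa using this.tendsto t₀
  have hρm : ρ ∈ Icc 0 ρ := ⟨hρ.le, le_rfl⟩
  have h1 : Tendsto (fun t => z t ρ) (𝓝 t₀) (𝓝 (y ρ)) := by
    rw [← (heq ρ hρm).1, tendsto_iff_norm_sub_tendsto_zero]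
    exact squeeze_zero (fun _ => norm_nonneg _) (fun t => (hL t _ (hz t)).1 ρ hρm) hlim
  have h2 : Tendsto (fun t : unitInterval => clippedFlux ν s δ μ (η / 2) t (z t) ρ) (𝓝 t₀)
      (𝓝 (clippedFlux ν s δ μ η t₀ y ρ)) := by
    rw [← (heq ρ hρm).2, tendsto_iff_norm_sub_tendsto_zero]
    exact squeeze_zero (fun _ => norm_nonneg _) (fun t => (hL t _ (hz t)).2) hlim
  filter_upwards [(h1.prodMk_nhds h2) ((hO ρ hρ).mem_nhds hyO),
    hlim.eventually (ge_mem_nhds hη2)] with t ht1 ht2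
  refine ⟨η / 2, ⟨hη2, hη21⟩, ρ, hρ, z t, hz t, fun x hx => ?_, ht1⟩
  have h3 := ((hL t _ (hz t)).1 x hx).trans ht2
  rw [(heq x hx).1, Prod.norm_def, max_le_iff] at h3
  have h4 := hyη x hx
  have h5 := (abs_le.1 h3.1).1
  have h6 := (abs_le.1 h3.2).1
  simp only [Prod.fst_sub, Prod.snd_sub] at h5 h6
  constructor <;> linarith

/-- Both components of the solution with parameter `t` are positive on the half-line; the lower
bound `η` may depend on the interval. -/
def StaysPositive (ν s δ μ t : ℝ) : Prop :=
  ∀ ρ > 0, ∃ η ∈ Ioc (0 : ℝ) 1, ∃ y, IsClippedSol ν s δ μ η t y ∧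
    ∀ x ∈ Icc 0 ρ, η ≤ (y x).1 ∧ η ≤ (y x).2

lemma IsPosSol.congr {P Q ρ ρ' : ℝ} {φ ψ M K φ' ψ' M' K' : ℝ → ℝ}
    (h : IsPosSol ν s δ μ P Q ρ' φ ψ M K) (hρ : ρ < ρ')
    (h1 : ∀ x ∈ Icc 0 ρ', φ' x = φ x) (h2 : ∀ x ∈ Icc 0 ρ', ψ' x = ψ x)
    (h3 : ∀ x ∈ Icc 0 ρ', M' x = M x) (h4 : ∀ x ∈ Icc 0 ρ', K' x = K x) (hρ' : 0 ≤ ρ') :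
    IsPosSol ν s δ μ P Q ρ φ' ψ' M' K' := by
  have hsub : Icc 0 ρ ⊆ Icc 0 ρ' := Icc_subset_Icc_right hρ.le
  have hm : ∀ x ∈ Ioc 0 ρ, x ∈ Icc 0 ρ' := fun x hx => hsub ⟨hx.1.le, hx.2⟩
  have hm' : ∀ x ∈ Ioc 0 ρ, x ∈ Ioc 0 ρ' := fun x hx => ⟨hx.1, hx.2.trans hρ.le⟩
  have hev : ∀ x ∈ Ioc 0 ρ, ∀ᶠ z in 𝓝 x, z ∈ Icc 0 ρ' := fun x hx =>
    Icc_mem_nhds hx.1 (hx.2.trans_lt hρ)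
  have h0 : (0 : ℝ) ∈ Icc 0 ρ' := ⟨le_rfl, hρ'⟩
  constructor
  · exact (h.contφ.mono hsub).congr fun x hx => h1 x (hsub hx)
  · exact (h.contψ.mono hsub).congr fun x hx => h2 x (hsub hx)
  · exact (h.contM.mono hsub).congr fun x hx => h3 x (hsub hx)
  · exact (h.contK.mono hsub).congr fun x hx => h4 x (hsub hx)
  · rw [h1 0 h0, h.φ_zero]
  · rw [h2 0 h0, h.ψ_zero]
  · rw [h3 0 h0, h.M_zero]
  · rw [h4 0 h0, h.K_zero]
  · intro x hx; rw [h1 x (hsub hx)]; exact h.φ_pos x (hsub hx)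
  · intro x hx; rw [h2 x (hsub hx)]; exact h.ψ_pos x (hsub hx)
  · intro x hx
    rw [h3 x (hm x hx)]
    exact (h.hasDerivAt_φ x (hm' x hx)).congr_of_eventuallyEq ((hev x hx).mono h1)
  · intro x hx
    rw [h4 x (hm x hx)]
    exact (h.hasDerivAt_ψ x (hm' x hx)).congr_of_eventuallyEq ((hev x hx).mono h2)
  · intro x hx
    rw [h1 x (hm x hx), h2 x (hm x hx)]
    exact (h.hasDerivAt_M x (hm' x hx)).congr_of_eventuallyEq ((hev x hx).mono h3)
  · intro x hx
    rw [h1 x (hm x hx), h2 x (hm x hx)]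
    exact (h.hasDerivAt_K x (hm' x hx)).congr_of_eventuallyEq ((hev x hx).mono h4)

/-- The solutions of the clipped systems agree where they are above the levels, and glue to one
solution on the half-line. -/
lemma StaysPositive.exists_isPosSol (h : StaysPositive ν s δ μ t) (hν : 0 < ν)
    (hs : 0 < s) (hδ : 0 < δ) (hμ : 0 < μ) (ht : t ∈ Icc (0 : ℝ) 1) :
    ∃ φ ψ M K : ℝ → ℝ, ∀ ρ, IsPosSol ν s δ μ (1 - t) t ρ φ ψ M K := by
  have h' : ∀ ρ : ℝ, ∃ η ∈ Ioc (0 : ℝ) 1, ∃ y, IsClippedSol ν s δ μ η t y ∧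
      ∀ x ∈ Icc 0 (|ρ| + 1), η ≤ (y x).1 ∧ η ≤ (y x).2 := fun ρ => h _ (by positivity)
  choose η hη y hy hyη using h'
  have hglue : ∀ a b x, x ∈ Icc 0 (|a| + 1) → x ∈ Icc 0 (|b| + 1) → y a x = y b x ∧
      clippedFlux ν s δ μ (η a) t (y a) x = clippedFlux ν s δ μ (η b) t (y b) x := by
    intro a b x ha hb
    rcases le_total (η a) (η b) with hab | hab
    · exact (hy b).eqOn_of_le hν (hη b).1 (hη b).2 hs hδ hμ ht (hyη b) (hη a).1 hab (hy a) hb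
    · have := (hy a).eqOn_of_le hν (hη a).1 (hη a).2 hs hδ hμ ht (hyη a) (hη b).1 hab (hy b) ha
      exact ⟨this.1.symm, this.2.symm⟩
  refine ⟨fun x => (y x x).1, fun x => (y x x).2,
    fun x => (clippedFlux ν s δ μ (η x) t (y x) x).1,
    fun x => (clippedFlux ν s δ μ (η x) t (y x) x).2, fun ρ => ?_⟩
  have hsol := (hy ρ).isPosSol hν (hη ρ).1 (hη ρ).2 hs hδ hμ ht (hyη ρ)
  have hself : ∀ x ∈ Icc 0 (|ρ| + 1), x ∈ Icc 0 (|x| + 1) := fun x hx =>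
    ⟨hx.1, (le_abs_self x).trans (by linarith)⟩
  refine hsol.congr ((le_abs_self ρ).trans_lt (by linarith)) ?_ ?_ ?_ ?_ (by positivity) <;>
    intro x hx <;> have := hglue x ρ x (hself x hx) hx
  · rw [this.1]
  · rw [this.1]
  · rw [this.2]
  · rw [this.2]

/-- A solution that does not stay positive comes down to every level `c` before a fixed `ρ₀`. -/
lemma exists_exit (h : ¬ StaysPositive ν s δ μ t) (hν : 0 < ν)
    (hs : 0 < s) (hδ : 0 < δ) (hμ : 0 < μ) (ht : t ∈ Icc (0 : ℝ) 1) :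
    ∃ ρ₀ > 0, ∀ c ∈ Ioo (0 : ℝ) 1, ∃ ρ ∈ Ioc 0 ρ₀, ∃ y, IsClippedSol ν s δ μ c t y ∧
      (∀ x ∈ Icc 0 ρ, c ≤ (y x).1 ∧ c ≤ (y x).2) ∧ min (y ρ).1 (y ρ).2 = c := by
  unfold StaysPositive at h
  push Not at h
  obtain ⟨ρ₀, hρ₀, hex⟩ := h
  refine ⟨ρ₀, hρ₀, fun c hc => ?_⟩
  obtain ⟨y, hy⟩ := exists_isClippedSol (t := t) hν hc.1 hc.2.le hs hδ hμ ht
  obtain ⟨x, hx, hxc⟩ := hex c ⟨hc.1, hc.2.le⟩ y hy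
  have hm : Continuous fun x => min (y x).1 (y x).2 :=
    (continuous_fst.comp hy.1).min (continuous_snd.comp hy.1)
  have hle : min (y x).1 (y x).2 ≤ c := by
    by_contra! hlt
    rw [lt_min_iff] at hlt
    exact absurd hlt.2 (not_lt.2 (hxc hlt.1.le).le)
  obtain ⟨ρ, hρ, hρc⟩ := intermediate_value_Icc' hx.1 hm.continuousOn
    (show c ∈ Icc (min (y x).1 (y x).2) (min (y 0).1 (y 0).2) from
      ⟨hle, by rw [hy.eq_zero]; simpa using hc.2.le⟩)
  simp only at hρc
  have hρ0 : ρ ≠ 0 := by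
    rintro rfl
    rw [hy.eq_zero] at hρc
    simp at hρc
    exact hc.2.ne hρc.symm
  refine ⟨ρ, ⟨lt_of_le_of_ne hρ.1 hρ0.symm, hρ.2.trans hx.2⟩, y, hy, fun z hz => ?_, hρc⟩
  have h1 := hy.antitoneOn hν hc.1 hc.2.le hs hδ hμ ht hz.1 hz.2
  have h2 := min_le_left (y ρ).1 (y ρ).2
  have h3 := min_le_right (y ρ).1 (y ρ).2
  rw [hρc] at h2 h3
  exact ⟨h2.trans h1.1, h3.trans h1.2⟩

end Clipped

/-! ### Shooting -/

/-- A lower bound, up to the factor `P`, of the flux `M` beyond `(ν + 1) / 2`. -/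
noncomputable def fluxConst (ν s δ : ℝ) : ℝ :=
  (1 / 2) ^ s * (1 / 2) ^ δ * (((ν + 1) / 2) ^ (ν + 1) / (ν + 1))

lemma fluxConst_pos {ν s δ : ℝ} (hν : 0 < ν) : 0 < fluxConst ν s δ := by
  unfold fluxConst
  positivity

/-- A condition on the values `a`, `b` of the two components at `ρ` and on the flux `m` of the first
one: the first component is so small that it has to vanish before the second one can drop to
`b / 2`, since the latter decreases with slope at most `1 / (ν + 1)`. -/
def VanishesFirst (ν ρ a b m : ℝ) : Prop :=
  a * (ρ + (ν + 1) * b / 2) ^ (ν + 1) < m * ((ν + 1) * b / 2)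

namespace IsPosSol

variable {ν s δ μ P Q ρ : ℝ} {φ ψ M K : ℝ → ℝ}

lemma one_sub_le_φ (h : IsPosSol ν s δ μ P Q ρ φ ψ M K) (hP : P ∈ Icc (0 : ℝ) 1)
    (hQ : Q ∈ Icc (0 : ℝ) 1) (hν : 0 < ν) (hs : 0 < s) (hδ : 0 < δ) {x : ℝ}
    (hx : x ∈ Icc 0 ρ) : 1 - x / (ν + 1) ≤ φ x := by
  have h1 := h.φ_sub_le hP.1 hQ.1 hν hs hδ le_rfl hx.1 hx.2
  rw [h.φ_zero, sub_zero] at h1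
  have h2 : P * x / (ν + 1) ≤ x / (ν + 1) := by
    have := mul_le_of_le_one_left hx.1 hP.2
    gcongr
  linarith

lemma half_le_of_φ_le_half (h : IsPosSol ν s δ μ P Q ρ φ ψ M K) (hP : P ∈ Icc (0 : ℝ) 1)
    (hQ : Q ∈ Icc (0 : ℝ) 1) (hν : 0 < ν) (hs : 0 < s) (hδ : 0 < δ) (hρ : 0 < ρ)
    (hφ : φ ρ ≤ 1 / 2) : (ν + 1) / 2 ≤ ρ := by
  have h1 := h.one_sub_le_φ hP hQ hν hs hδ ⟨hρ.le, le_rfl⟩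
  have h2 : 1 / 2 ≤ ρ / (ν + 1) := by linarith
  rw [le_div_iff₀ (by positivity)] at h2
  linarith

lemma mul_fluxConst_le (h : IsPosSol ν s δ μ P Q ρ φ ψ M K) (hP : P ∈ Icc (0 : ℝ) 1)
    (hQ : Q ∈ Icc (0 : ℝ) 1) (hν : 0 < ν) (hs : 0 < s) (hδ : 0 < δ) (hμ : 0 < μ)
    (hρ : (ν + 1) / 2 ≤ ρ) : P * fluxConst ν s δ ≤ M ρ := by
  have h0 : 0 < (ν + 1) / 2 := by positivity
  have hm : (ν + 1) / 2 ∈ Icc 0 ρ := ⟨h0.le, hρ⟩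
  have e : 1 - (ν + 1) / 2 / (ν + 1) = 1 / 2 := by field_simp; norm_num
  have h1 := h.one_sub_le_φ hP hQ hν hs hδ hm
  have h2 := h.swap.one_sub_le_φ hQ hP hν hs hμ hm
  rw [e] at h1 h2
  have h3 := h.source_mul_le_M hP.1 hQ.1 hν hs hδ hm
  have h4 := h.monotoneOn_M hP.1 hm ⟨h0.le.trans hρ, le_rfl⟩ hρ
  refine le_trans ?_ (h3.trans h4)
  rw [fluxConst, ← mul_assoc]
  have := hP.1
  gcongr

lemma half_le_of_vanishesFirst (h : IsPosSol ν s δ μ P Q ρ φ ψ M K) (hP : P ∈ Icc (0 : ℝ) 1)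
    (hQ : Q ∈ Icc (0 : ℝ) 1) (hν : 0 < ν) (hs : 0 < s) (hμ : 0 < μ) {ρ₁ : ℝ}
    (hρ₁ : 0 < ρ₁) (hρ : ρ₁ ≤ ρ) (hc : VanishesFirst ν ρ₁ (φ ρ₁) (ψ ρ₁) (M ρ₁)) :
    ψ ρ₁ / 2 ≤ ψ ρ := by
  have hψ := h.ψ_pos ρ₁ ⟨hρ₁.le, hρ⟩
  have h1 := h.lt_add_of_φ_lt hP.1 hν hρ₁ (k := (ν + 1) * ψ ρ₁ / 2) (by positivity) hρ hc
  have h2 := h.swap.φ_sub_le hQ.1 hP.1 hν hs hμ hρ₁.le hρ le_rfl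
  have h3 : Q * (ρ - ρ₁) / (ν + 1) ≤ ψ ρ₁ / 2 := by
    rw [div_le_iff₀ (by positivity)]
    have := mul_le_of_le_one_left (sub_nonneg.2 hρ) hQ.2
    linarith
  linarith

lemma ψ_le_of_not_vanishesFirst (h : IsPosSol ν s δ μ P Q ρ φ ψ M K) (hP : P ∈ Icc (0 : ℝ) 1)
    (hP0 : 0 < P) (hQ : Q ∈ Icc (0 : ℝ) 1) (hν : 0 < ν) (hs : 0 < s) (hδ : 0 < δ) (hμ : 0 < μ)
    {ρ₀ : ℝ} (hρ : (ν + 1) / 2 ≤ ρ) (hρ₀ : ρ ≤ ρ₀)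
    (hc : ¬ VanishesFirst ν ρ (φ ρ) (ψ ρ) (M ρ)) :
    ψ ρ ≤ 2 * (ρ₀ + (ν + 1)) ^ (ν + 1) / ((ν + 1) * (P * fluxConst ν s δ)) * φ ρ := by
  have hρ0 : 0 < ρ := lt_of_lt_of_le (by positivity) hρ
  have hm : ρ ∈ Icc 0 ρ := ⟨hρ0.le, le_rfl⟩
  have hφ := h.φ_pos ρ hm
  have hψ := h.ψ_pos ρ hm
  have hψ1 := h.swap.φ_le_one hQ.1 hm
  have hM := h.mul_fluxConst_le hP hQ hν hs hδ hμ hρ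
  have hm0 : 0 < P * fluxConst ν s δ := mul_pos hP0 (fluxConst_pos hν)
  unfold VanishesFirst at hc
  rw [not_lt] at hc
  rw [div_mul_eq_mul_div, le_div_iff₀ (by positivity)]
  have h1 : φ ρ * (ρ + (ν + 1) * ψ ρ / 2) ^ (ν + 1) ≤ φ ρ * (ρ₀ + (ν + 1)) ^ (ν + 1) := by
    have : (ν + 1) * ψ ρ / 2 ≤ ν + 1 := by nlinarith
    gcongr
  have h2 : P * fluxConst ν s δ * ((ν + 1) * ψ ρ / 2) ≤ M ρ * ((ν + 1) * ψ ρ / 2) := by gcongr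
  linarith

/-- The slope is large where the solution is small. -/
lemma le_slope (h : IsPosSol ν s δ μ P Q ρ φ ψ M K) (hP : P ∈ Icc (0 : ℝ) 1)
    (hP0 : 0 < P) (hQ : Q ∈ Icc (0 : ℝ) 1) (hν : 0 < ν) (hs : 0 < s) (hδ : 0 < δ) (hμ : 0 < μ)
    {ρ₀ ε B : ℝ} (hρ : (ν + 1) / 2 ≤ ρ) (hρ₀ : ρ ≤ ρ₀) (hB : 0 < B) (hφ : φ ρ ≤ ε)
    (hε : ε * B ≤ ρ₀ ^ (-ν) * (P * fluxConst ν s δ)) : B ≤ ρ ^ (-ν) * M ρ / φ ρ := by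
  have hρ0 : 0 < ρ := lt_of_lt_of_le (by positivity) hρ
  have hφ0 := h.φ_pos ρ ⟨hρ0.le, le_rfl⟩
  have hM := h.mul_fluxConst_le hP hQ hν hs hδ hμ hρ
  have hm0 : 0 < P * fluxConst ν s δ := mul_pos hP0 (fluxConst_pos hν)
  rw [le_div_iff₀ hφ0]
  have h1 : ρ₀ ^ (-ν) ≤ ρ ^ (-ν) := Real.rpow_le_rpow_of_nonpos hρ0 hρ₀ (by linarith)
  have h2 : ρ₀ ^ (-ν) * (P * fluxConst ν s δ) ≤ ρ ^ (-ν) * M ρ := by gcongr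
  nlinarith

end IsPosSol

section Shooting

variable {ν s δ μ : ℝ}

lemma isOpen_vanishesFirst (hν : 0 < ν) {α : Type*} [TopologicalSpace α] (ρ : ℝ) {a b m : α → ℝ}
    (ha : Continuous a) (hb : Continuous b) (hm : Continuous m) :
    IsOpen {p | VanishesFirst ν ρ (a p) (b p) (m p)} := by
  have hc : Continuous fun x : ℝ => x ^ (ν + 1) := Real.continuous_rpow_const (by positivity)
  exact isOpen_lt (ha.mul (hc.comp (by fun_prop))) (by fun_prop)

/-- At some point up to which the solution with parameter `t` is positive, the criterion for the
first component to vanish first holds. -/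
def FstVanishes (ν s δ μ t : ℝ) : Prop :=
  Reaches ν s δ μ (fun ρ => {p | VanishesFirst ν ρ p.1.1 p.1.2 p.2.1}) t

/-- At some point up to which the solution with parameter `t` is positive, the criterion for the
second component to vanish first holds. -/
def SndVanishes (ν s δ μ t : ℝ) : Prop :=
  Reaches ν s δ μ (fun ρ => {p | VanishesFirst ν ρ p.1.2 p.1.1 p.2.2}) t

/-- If each component vanished before the other, both would stay above a positive level for as
long as the solution exists, so that it could be continued. -/
lemma not_fstVanishes_and_sndVanishes (hν : 0 < ν) (hs : 0 < s) (hδ : 0 < δ) (hμ : 0 < μ)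
    {t : ℝ} (ht : t ∈ Icc (0 : ℝ) 1) (hn : ¬ StaysPositive ν s δ μ t)
    (h1 : FstVanishes ν s δ μ t) (h2 : SndVanishes ν s δ μ t) : False := by
  obtain ⟨ρ₀, hρ₀, hexit⟩ := exists_exit hn hν hs hδ hμ ht
  obtain ⟨η₁, hη₁, ρ₁, hρ₁, y₁, hy₁, hyη₁, hO₁⟩ := h1
  obtain ⟨η₂, hη₂, ρ₂, hρ₂, y₂, hy₂, hyη₂, hO₂⟩ := h2
  have a1 := hyη₁ ρ₁ ⟨hρ₁.le, le_rfl⟩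
  have a2 := hyη₂ ρ₂ ⟨hρ₂.le, le_rfl⟩
  have ht' : 1 - t ∈ Icc (0 : ℝ) 1 := ⟨by linarith [ht.2], by linarith [ht.1]⟩
  set c := min η₁ η₂ / 3 with hc
  have hmin := lt_min hη₁.1 hη₂.1
  have hc0 : 0 < c := by positivity
  have hc1 : c < η₁ / 2 := by have := min_le_left η₁ η₂; linarith [hη₁.1]
  have hc2 : c < η₂ / 2 := by have := min_le_right η₁ η₂; linarith [hη₂.1]
  obtain ⟨ρ, hρ, y, hy, hyc, hmc⟩ := hexit c ⟨hc0, by linarith [hη₁.2]⟩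
  have hc1' : c ≤ 1 := by linarith [hη₁.2]
  have hm : ρ ∈ Icc 0 ρ := ⟨hρ.1.le, le_rfl⟩
  have hsol := hy.isPosSol hν hc0 hc1' hs hδ hμ ht hyc
  have hlt : ∀ {η ρ' : ℝ} {y' : ℝ → ℝ × ℝ}, IsClippedSol ν s δ μ η t y' → η ∈ Ioc (0 : ℝ) 1 →
      (∀ x ∈ Icc 0 ρ', η ≤ (y' x).1 ∧ η ≤ (y' x).2) → c < η / 2 → ρ' ≤ ρ := by
    intro η ρ' y' hy' hη hyη' hcη
    by_contra! hlt
    have := (hy'.eqOn_of_le hν hη.1 hη.2 hs hδ hμ ht hyη' hc0 (by linarith [hη.1]) hy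
      ⟨hρ.1.le, hlt.le⟩).1
    have h3 := hyη' ρ ⟨hρ.1.le, hlt.le⟩
    rw [← this] at h3
    have := le_min h3.1 h3.2
    rw [hmc] at this
    linarith [hη.1]
  have e1 := hy₁.eqOn_of_le hν hη₁.1 hη₁.2 hs hδ hμ ht hyη₁ hc0 (by linarith [hη₁.1]) hy
    ⟨hρ₁.le, le_rfl⟩
  have e2 := hy₂.eqOn_of_le hν hη₂.1 hη₂.2 hs hδ hμ ht hyη₂ hc0 (by linarith [hη₂.1]) hy
    ⟨hρ₂.le, le_rfl⟩
  rw [← e1.1, ← e1.2] at hO₁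
  rw [← e2.1, ← e2.2] at hO₂
  rw [← e1.1] at a1
  rw [← e2.1] at a2
  have b1 := hsol.half_le_of_vanishesFirst ht' ht hν hs hμ hρ₁ (hlt hy₁ hη₁ hyη₁ hc1) hO₁
  have b2 := hsol.swap.half_le_of_vanishesFirst ht ht' hν hs hδ hρ₂ (hlt hy₂ hη₂ hyη₂ hc2) hO₂
  have : c < min (y ρ).1 (y ρ).2 := lt_min (by linarith) (by linarith)
  linarith

/-- For `t = 0` the second component is constant, so only the first one can vanish. -/
lemma fstVanishes_zero (hν : 0 < ν) (hs : 0 < s) (hδ : 0 < δ) (hμ : 0 < μ)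
    (hn : ¬ StaysPositive ν s δ μ 0) : FstVanishes ν s δ μ 0 := by
  have ht : (0 : ℝ) ∈ Icc (0 : ℝ) 1 := ⟨le_rfl, zero_le_one⟩
  have ht' : (1 : ℝ) - 0 ∈ Icc (0 : ℝ) 1 := by norm_num
  obtain ⟨ρ₀, hρ₀, hexit⟩ := exists_exit hn hν hs hδ hμ ht
  by_contra hA
  set a := 2 * (ρ₀ + (ν + 1)) ^ (ν + 1) / ((ν + 1) * ((1 - 0) * fluxConst ν s δ)) with ha
  have hf := fluxConst_pos (s := s) (δ := δ) hν
  have ha0 : 0 < a := by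
    rw [ha, sub_zero, one_mul]
    positivity
  set c := min (1 / 2) (1 / (2 * a)) with hc
  have hc0 : 0 < c := lt_min (by norm_num) (by positivity)
  have hc1 : c ≤ 1 / 2 := min_le_left _ _
  obtain ⟨ρ, hρ, y, hy, hyc, hmc⟩ := hexit c ⟨hc0, by linarith⟩
  have hsol := hy.isPosSol hν hc0 (by linarith) hs hδ hμ ht hyc
  have hm : ρ ∈ Icc 0 ρ := ⟨hρ.1.le, le_rfl⟩
  have hψ : 1 ≤ (y ρ).2 := by
    have := hsol.swap.φ_sub_le le_rfl ht'.1 hν hs hμ le_rfl hρ.1.le le_rfl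
    rw [hsol.ψ_zero] at this
    simpa using this
  have hφ : (y ρ).1 = c := by
    rcases min_choice (y ρ).1 (y ρ).2 with h | h
    · rw [← h, hmc]
    · rw [h] at hmc; linarith
  have hhalf := hsol.half_le_of_φ_le_half ht' ht hν hs hδ hρ.1 (by linarith)
  have := hsol.ψ_le_of_not_vanishesFirst ht' (by norm_num) ht hν hs hδ hμ hhalf hρ.2
    (fun hv => hA ⟨c, ⟨hc0, by linarith⟩, ρ, hρ.1, y, hy, hyc, hv⟩)
  simp only [← ha, hφ] at this
  have h2 : a * c ≤ 1 / 2 := by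
    calc a * c ≤ a * (1 / (2 * a)) := by gcongr; exact min_le_right _ _
      _ = 1 / 2 := by field_simp
  linarith

/-- For `t = 1` the first component is constant, so only the second one can vanish. -/
lemma sndVanishes_one (hν : 0 < ν) (hs : 0 < s) (hδ : 0 < δ) (hμ : 0 < μ)
    (hn : ¬ StaysPositive ν s δ μ 1) : SndVanishes ν s δ μ 1 := by
  have ht : (1 : ℝ) ∈ Icc (0 : ℝ) 1 := ⟨zero_le_one, le_rfl⟩
  have ht' : (1 : ℝ) - 1 ∈ Icc (0 : ℝ) 1 := by norm_num
  obtain ⟨ρ₀, hρ₀, hexit⟩ := exists_exit hn hν hs hδ hμ ht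
  by_contra hA
  set a := 2 * (ρ₀ + (ν + 1)) ^ (ν + 1) / ((ν + 1) * (1 * fluxConst ν s μ)) with ha
  have hf := fluxConst_pos (s := s) (δ := μ) hν
  have ha0 : 0 < a := by positivity
  set c := min (1 / 2) (1 / (2 * a)) with hc
  have hc0 : 0 < c := lt_min (by norm_num) (by positivity)
  have hc1 : c ≤ 1 / 2 := min_le_left _ _
  obtain ⟨ρ, hρ, y, hy, hyc, hmc⟩ := hexit c ⟨hc0, by linarith⟩
  have hsol := hy.isPosSol hν hc0 (by linarith) hs hδ hμ ht hyc
  have hm : ρ ∈ Icc 0 ρ := ⟨hρ.1.le, le_rfl⟩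
  have hψ : 1 ≤ (y ρ).1 := by
    have := hsol.φ_sub_le ht'.1 ht.1 hν hs hδ le_rfl hρ.1.le le_rfl
    rw [hsol.φ_zero] at this
    simpa using this
  have hφ : (y ρ).2 = c := by
    rcases min_choice (y ρ).1 (y ρ).2 with h | h
    · rw [h] at hmc; linarith
    · rw [← h, hmc]
  have hhalf := hsol.swap.half_le_of_φ_le_half ht ht' hν hs hμ hρ.1 (by linarith)
  have := hsol.swap.ψ_le_of_not_vanishesFirst ht one_pos ht' hν hs hμ hδ hhalf hρ.2
    (fun hv => hA ⟨c, ⟨hc0, by linarith⟩, ρ, hρ.1, y, hy, hyc, hv⟩)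
  simp only [← ha, hφ] at this
  have h2 : a * c ≤ 1 / 2 := by
    calc a * c ≤ a * (1 / (2 * a)) := by gcongr; exact min_le_right _ _
      _ = 1 / 2 := by field_simp
  linarith

/-- Above the curve, one of the components vanishes strictly before the other: if neither criterion
holds at a low level `c`, both components are of order `c`, so both slopes are large there. -/
lemma fstVanishes_or_sndVanishes (hν : 0 < ν) (hs : 0 < s) (hδ : 0 < δ) (hμ : 0 < μ)
    (habove : (ν + 1) / (μ + 1) + (ν + 1) / (δ + 1) <
      ν + ν * s / 2 * min (1 / (μ + 1)) (1 / (δ + 1)))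
    {t : ℝ} (ht : t ∈ Ioo (0 : ℝ) 1) (hn : ¬ StaysPositive ν s δ μ t) :
    FstVanishes ν s δ μ t ∨ SndVanishes ν s δ μ t := by
  by_contra! hAB
  have htI : t ∈ Icc (0 : ℝ) 1 := ⟨ht.1.le, ht.2.le⟩
  have htI' : 1 - t ∈ Icc (0 : ℝ) 1 := ⟨by linarith [ht.2], by linarith [ht.1]⟩
  have ht' : 0 < 1 - t := by linarith [ht.2]
  have ht0 := ht.1
  obtain ⟨ρ₀, hρ₀, hexit⟩ := exists_exit hn hν hs hδ hμ htI
  have hf := fluxConst_pos (s := s) (δ := δ) hν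
  have hg := fluxConst_pos (s := s) (δ := μ) hν
  set a := 2 * (ρ₀ + (ν + 1)) ^ (ν + 1) / ((ν + 1) * ((1 - t) * fluxConst ν s δ)) with ha
  set b := 2 * (ρ₀ + (ν + 1)) ^ (ν + 1) / ((ν + 1) * (t * fluxConst ν s μ)) with hb
  have ha0 : 0 < a := by positivity
  have hb0 : 0 < b := by positivity
  set B := max ν (2 * (ν + 1)) with hB
  have hB0 : 0 < B := lt_max_of_lt_left hν
  set m := min (ρ₀ ^ (-ν) * ((1 - t) * fluxConst ν s δ)) (ρ₀ ^ (-ν) * (t * fluxConst ν s μ))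
    with hm
  have hm0 : 0 < m := lt_min (by positivity) (by positivity)
  set c := min (1 / 2) (m / ((1 + a + b) * B)) with hc
  have hc0 : 0 < c := lt_min (by norm_num) (by positivity)
  have hc1 : c ≤ 1 / 2 := min_le_left _ _
  have hcm : (1 + a + b) * c * B ≤ m := by
    have : c ≤ m / ((1 + a + b) * B) := min_le_right _ _
    rw [le_div_iff₀ (by positivity)] at this
    linarith
  obtain ⟨ρ, hρ, y, hy, hyc, hmc⟩ := hexit c ⟨hc0, by linarith⟩
  have hsol := hy.isPosSol hν hc0 (by linarith) hs hδ hμ htI hyc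
  have hhalf : (ν + 1) / 2 ≤ ρ := by
    rcases min_choice (y ρ).1 (y ρ).2 with h | h
    · exact hsol.half_le_of_φ_le_half htI' htI hν hs hδ hρ.1 (by linarith)
    · exact hsol.swap.half_le_of_φ_le_half htI htI' hν hs hμ hρ.1 (by linarith)
  have h1 := hsol.ψ_le_of_not_vanishesFirst htI' ht' htI hν hs hδ hμ hhalf hρ.2
    (fun hv => hAB.1 ⟨c, ⟨hc0, by linarith⟩, ρ, hρ.1, y, hy, hyc, hv⟩)
  have h2 := hsol.swap.ψ_le_of_not_vanishesFirst htI ht0 htI' hν hs hμ hδ hhalf hρ.2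
    (fun hv => hAB.2 ⟨c, ⟨hc0, by linarith⟩, ρ, hρ.1, y, hy, hyc, hv⟩)
  simp only [← ha, ← hb] at h1 h2
  have hac := mul_pos ha0 hc0
  have hbc := mul_pos hb0 hc0
  have h3 : (y ρ).1 ≤ (1 + a + b) * c ∧ (y ρ).2 ≤ (1 + a + b) * c := by
    rcases min_choice (y ρ).1 (y ρ).2 with h | h <;> rw [h] at hmc <;> rw [hmc] at h1 h2 ⊢ <;>
      constructor <;> linarith
  exact hsol.not_large_slopes htI'.1 htI.1 hν hs hδ hμ hρ.1 habove
    (hsol.le_slope htI' ht' htI hν hs hδ hμ hhalf hρ.2 hB0 h3.1 (hcm.trans (min_le_left _ _)))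
    (hsol.swap.le_slope htI ht0 htI' hν hs hμ hδ hhalf hρ.2 hB0 h3.2
      (hcm.trans (min_le_right _ _)))

/-- For critical or supercritical `s` every solution stays positive. -/
lemma staysPositive_of_supercritical (hν : 0 < ν) (hs : 0 < s) (hδ : 0 < δ) (hμ : 0 < μ)
    (hcrit : (ν + 1) / (s + 1) ≤ ν / 2) {t : ℝ} (ht : t ∈ Ioo (0 : ℝ) 1) :
    StaysPositive ν s δ μ t := by
  by_contra hn
  have htI : t ∈ Icc (0 : ℝ) 1 := ⟨ht.1.le, ht.2.le⟩
  have htI' : 1 - t ∈ Icc (0 : ℝ) 1 := ⟨by linarith [ht.2], by linarith [ht.1]⟩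
  have ht' : 0 < 1 - t := by linarith [ht.2]
  have ht0 := ht.1
  obtain ⟨ρ₀, hρ₀, hexit⟩ := exists_exit hn hν hs hδ hμ htI
  have hf := fluxConst_pos (s := s) (δ := δ) hν
  have hg := fluxConst_pos (s := s) (δ := μ) hν
  set m := min (ρ₀ ^ (-ν) * ((1 - t) * fluxConst ν s δ)) (ρ₀ ^ (-ν) * (t * fluxConst ν s μ))
    with hm
  have hm0 : 0 < m := lt_min (by positivity) (by positivity)
  set c := min (1 / 2) (m / (ν + 1)) with hc
  have hc0 : 0 < c := lt_min (by norm_num) (by positivity)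
  have hc1 : c ≤ 1 / 2 := min_le_left _ _
  have hcm : c * (ν + 1) ≤ m := by
    have : c ≤ m / (ν + 1) := min_le_right _ _
    rwa [le_div_iff₀ (by positivity)] at this
  obtain ⟨ρ, hρ, y, hy, hyc, hmc⟩ := hexit c ⟨hc0, by linarith⟩
  have hsol := hy.isPosSol hν hc0 (by linarith) hs hδ hμ htI hyc
  rcases min_choice (y ρ).1 (y ρ).2 with h | h
  · have hhalf := hsol.half_le_of_φ_le_half htI' htI hν hs hδ hρ.1 (by linarith)
    have h1 := hsol.le_slope htI' ht' htI hν hs hδ hμ hhalf hρ.2 (B := ν + 1) (by positivity)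
      (h.symm.trans hmc).le (hcm.trans (min_le_left _ _))
    have h2 := hsol.slope_le_of_supercritical htI'.1 htI.1 hν hs hδ hρ.1 hcrit
    linarith
  · have hhalf := hsol.swap.half_le_of_φ_le_half htI htI' hν hs hμ hρ.1 (by linarith)
    have h1 := hsol.swap.le_slope htI ht0 htI' hν hs hμ hδ hhalf hρ.2 (B := ν + 1)
      (by positivity) (h.symm.trans hmc).le (hcm.trans (min_le_right _ _))
    have h2 := hsol.swap.slope_le_of_supercritical htI.1 htI'.1 hν hs hμ hρ.1 hcrit
    linarith

/-- Shooting: above the curve, some parameter gives a solution positive on the half-line. -/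
theorem exists_staysPositive (hν : 0 < ν) (hs : 0 < s) (hδ : 0 < δ) (hμ : 0 < μ)
    (habove : (ν + 1) / (μ + 1) + (ν + 1) / (δ + 1) <
      ν + ν * s / 2 * min (1 / (μ + 1)) (1 / (δ + 1))) :
    ∃ t ∈ Ioo (0 : ℝ) 1, StaysPositive ν s δ μ t := by
  rcases le_or_gt ((ν + 1) / (s + 1)) (ν / 2) with hcrit | hcrit
  · exact ⟨1 / 2, by norm_num, staysPositive_of_supercritical hν hs hδ hμ hcrit (by norm_num)⟩
  by_contra! hno
  have h0 : ¬ StaysPositive ν s δ μ 0 := fun h => by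
    obtain ⟨φ, ψ, M, K, hsol⟩ := h.exists_isPosSol hν hs hδ hμ ⟨le_rfl, zero_le_one⟩
    rw [sub_zero] at hsol
    exact IsPosSol.not_global_scalar hsol hν hs hδ hμ hcrit
  have h1 : ¬ StaysPositive ν s δ μ 1 := fun h => by
    obtain ⟨φ, ψ, M, K, hsol⟩ := h.exists_isPosSol hν hs hδ hμ ⟨zero_le_one, le_rfl⟩
    rw [sub_self] at hsol
    exact IsPosSol.not_global_scalar (fun ρ => (hsol ρ).swap) hν hs hμ hδ hcrit
  have hall : ∀ t ∈ Icc (0 : ℝ) 1, ¬ StaysPositive ν s δ μ t := fun t ht => by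
    rcases ht.1.eq_or_lt with rfl | h0'
    · exact h0
    · rcases ht.2.eq_or_lt with rfl | h1'
      · exact h1
      · exact hno t ⟨h0', h1'⟩
  have hcover : ∀ t ∈ Icc (0 : ℝ) 1, FstVanishes ν s δ μ t ∨ SndVanishes ν s δ μ t :=
    fun t ht => by
    rcases ht.1.eq_or_lt with rfl | h0'
    · exact Or.inl (fstVanishes_zero hν hs hδ hμ h0)
    · rcases ht.2.eq_or_lt with rfl | h1'
      · exact Or.inr (sndVanishes_one hν hs hδ hμ h1)
      · exact fstVanishes_or_sndVanishes hν hs hδ hμ habove ⟨h0', h1'⟩ (hno t ⟨h0', h1'⟩)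
  have hA : IsOpen {t : unitInterval | FstVanishes ν s δ μ t} :=
    isOpen_reaches hν hs hδ hμ fun ρ _ => isOpen_vanishesFirst hν ρ (by fun_prop) (by fun_prop)
      (by fun_prop)
  have hB : IsOpen {t : unitInterval | SndVanishes ν s δ μ t} :=
    isOpen_reaches hν hs hδ hμ fun ρ _ => isOpen_vanishesFirst hν ρ (by fun_prop) (by fun_prop)
      (by fun_prop)
  obtain ⟨t, -, htA, htB⟩ := isPreconnected_univ (α := unitInterval) _ _ hA hB
    (fun t _ => hcover t t.2) ⟨0, mem_univ _, fstVanishes_zero hν hs hδ hμ h0⟩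
    ⟨1, mem_univ _, sndVanishes_one hν hs hδ hμ h1⟩
  exact not_fstVanishes_and_sndVanishes hν hs hδ hμ t.2 (hall t t.2) htA htB

end Shooting

/-! ### From profiles to radial functions on `ℝ^N` -/

section RadialLaplacian

variable {N : ℕ}

lemma hasFDerivAt_radial {U : ℝ → ℝ} {u' : ℝ} {z : EuclideanSpace ℝ (Fin N)} (hz : z ≠ 0)
    (hU : HasDerivAt U u' ‖z‖) :
    HasFDerivAt (fun z : EuclideanSpace ℝ (Fin N) => U ‖z‖) ((u' / ‖z‖) • innerSL ℝ z) z := by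
  have hz0 : ‖z‖ ≠ 0 := norm_ne_zero_iff.2 hz
  have h1 : HasFDerivAt (fun z : EuclideanSpace ℝ (Fin N) => √(‖z‖ ^ 2))
      ((1 / (2 * √(‖z‖ ^ 2))) • (2 • innerSL ℝ z)) z :=
    (hasStrictFDerivAt_norm_sq z).hasFDerivAt.sqrt (by positivity)
  simp only [Real.sqrt_sq (norm_nonneg _)] at h1
  refine (hU.comp_hasFDerivAt z h1).congr_fderiv ?_
  ext v
  simp
  field_simp

/-- The Laplacian of a radial function in terms of its profile. -/
lemma laplacian_radialLift {U U₁ : ℝ → ℝ} {u₂ : ℝ} {x : EuclideanSpace ℝ (Fin N)} (hx : x ≠ 0)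
    (hU : ∀ r, 0 < r → HasDerivAt U (U₁ r) r) (hU₁ : HasDerivAt U₁ u₂ ‖x‖) :
    Laplacian.laplacian (radialLift N U) x = u₂ + ((N : ℝ) - 1) / ‖x‖ * U₁ ‖x‖ := by
  have hx0 : ‖x‖ ≠ 0 := norm_ne_zero_iff.2 hx
  have h1 : fderiv ℝ (radialLift N U) =ᶠ[𝓝 x] fun z => (U₁ ‖z‖ / ‖z‖) • innerSL ℝ z := by
    filter_upwards [isOpen_ne.mem_nhds hx] with z hz
    exact (hasFDerivAt_radial hz (hU _ (norm_pos_iff.2 hz))).fderiv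
  have h2 : HasFDerivAt (fun z : EuclideanSpace ℝ (Fin N) => U₁ ‖z‖ / ‖z‖) _ x :=
    hasFDerivAt_radial (U := fun r => U₁ r / r) hx (hU₁.div (hasDerivAt_id _) hx0)
  have h3 : DifferentiableAt ℝ (fderiv ℝ (radialLift N U)) x :=
    h1.differentiableAt_iff.2 (h2.differentiableAt.smul
      (innerSL ℝ (E := EuclideanSpace ℝ (Fin N))).differentiableAt)
  have hterm : ∀ e : EuclideanSpace ℝ (Fin N), inner ℝ e e = (1 : ℝ) →
      fderiv ℝ (fderiv ℝ (radialLift N U)) x e e = U₁ ‖x‖ / ‖x‖ +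
        (u₂ * ‖x‖ - U₁ ‖x‖ * 1) / ‖x‖ ^ 2 / ‖x‖ * inner ℝ x e ^ 2 := by
    intro e he
    have a1 := h3.hasFDerivAt.clm_apply (hasFDerivAt_const e x)
    have a2 : HasFDerivAt (fun z : EuclideanSpace ℝ (Fin N) => inner ℝ e z) (innerSL ℝ e) x :=
      (innerSL ℝ e).hasFDerivAt
    have a3 : (fun z => fderiv ℝ (radialLift N U) z e) =ᶠ[𝓝 x]
        fun z => U₁ ‖z‖ / ‖z‖ * inner ℝ e z := by
      filter_upwards [h1] with z hz
      rw [hz, real_inner_comm]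
      rfl
    have a4 := congrArg (fun L => L e) (a1.unique ((h2.mul a2).congr_of_eventuallyEq a3))
    simp [real_inner_comm x e] at a4
    rw [real_inner_self_eq_norm_sq] at he
    rw [a4, he]
    ring
  have hsum := (EuclideanSpace.basisFun (Fin N) ℝ).sum_sq_inner_left x
  rw [InnerProductSpace.laplacian_eq_iteratedFDeriv_orthonormalBasis _
    (EuclideanSpace.basisFun (Fin N) ℝ)]
  simp only [iteratedFDeriv_two_apply]
  simp only [Matrix.cons_val_zero, Matrix.cons_val_one]
  rw [Finset.sum_congr rfl fun i _ => hterm (EuclideanSpace.basisFun (Fin N) ℝ i) (by simp),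
    Finset.sum_add_distrib, ← Finset.mul_sum, hsum]
  simp
  field_simp
  ring

end RadialLaplacian

lemma contDiffOn_two_of_hasDerivAt {U U₁ U₂ : ℝ → ℝ} {S : Set ℝ} (hS : IsOpen S)
    (h1 : ∀ r ∈ S, HasDerivAt U (U₁ r) r) (h2 : ∀ r ∈ S, HasDerivAt U₁ (U₂ r) r)
    (hc : ContinuousOn U₂ S) : ContDiffOn ℝ 2 U S := by
  have e1 : ContDiffOn ℝ 1 U₁ S := by
    rw [show (1 : WithTop ℕ∞) = 0 + 1 by simp, contDiffOn_succ_iff_deriv_of_isOpen hS]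
    refine ⟨fun r hr => (h2 r hr).differentiableAt.differentiableWithinAt, by simp, ?_⟩
    rw [contDiffOn_zero]
    exact hc.congr fun r hr => (h2 r hr).deriv
  rw [show (2 : WithTop ℕ∞) = 1 + 1 by norm_num, contDiffOn_succ_iff_deriv_of_isOpen hS]
  exact ⟨fun r hr => (h1 r hr).differentiableAt.differentiableWithinAt, by simp,
    e1.congr fun r hr => (h1 r hr).deriv⟩

namespace IsPosSol

variable {ν s δ μ P Q : ℝ} {φ ψ M K : ℝ → ℝ} {n b A : ℝ}

lemma continuousOn_Ici (h : ∀ ρ, IsPosSol ν s δ μ P Q ρ φ ψ M K) : ContinuousOn φ (Ici 0) := by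
  intro x hx
  have := (h (x + 1)).contφ x ⟨hx, by linarith⟩
  apply this.mono_of_mem_nhdsWithin
  filter_upwards [self_mem_nhdsWithin, mem_nhdsWithin_of_mem_nhds
    (Iic_mem_nhds (show x < x + 1 by linarith))] with z hz hz'
  exact ⟨hz, hz'⟩

/-- The profile `r ↦ A φ(r^b)` with `b = a + 2`; the change of variable `x = r^b` turns the weight
`|x|^a` into a constant. -/
lemma hasDerivAt_profile (h : ∀ ρ, IsPosSol ν s δ μ P Q ρ φ ψ M K) (hn : ν * b = n) (A : ℝ)
    {r : ℝ} (hr : 0 < r) :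
    HasDerivAt (fun r => A * φ (r ^ b)) (-(A * b) * (r ^ (-(n + 1)) * M (r ^ b))) r := by
  have hb0 := Real.rpow_pos_of_pos hr b
  have h1 := ((h _).hasDerivAt_φ _ ⟨hb0, le_rfl⟩).comp r
    (Real.hasDerivAt_rpow_const (x := r) (p := b) (Or.inl hr.ne'))
  refine (h1.const_mul A).congr_deriv ?_
  have e : (r ^ b) ^ (-(ν + 1)) * r ^ (b - 1) = r ^ (-(n + 1)) := by
    rw [← Real.rpow_mul hr.le, ← Real.rpow_add hr, ← hn]
    congr 1; ring
  rw [← e]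
  ring

lemma hasDerivAt_profile_deriv (h : ∀ ρ, IsPosSol ν s δ μ P Q ρ φ ψ M K) (hn : ν * b = n)
    (A : ℝ) {r : ℝ} (hr : 0 < r) :
    HasDerivAt (fun r => -(A * b) * (r ^ (-(n + 1)) * M (r ^ b)))
      (-((n + 1) / r * (-(A * b) * (r ^ (-(n + 1)) * M (r ^ b))))
        - r ^ (b - 2) * (A * (b ^ 2 * P) * (φ (r ^ b) ^ s * ψ (r ^ b) ^ δ))) r := by
  have hb0 := Real.rpow_pos_of_pos hr b
  have h1 := ((h _).hasDerivAt_M _ ⟨hb0, le_rfl⟩).comp r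
    (Real.hasDerivAt_rpow_const (x := r) (p := b) (Or.inl hr.ne'))
  have h2 := (Real.hasDerivAt_rpow_const (x := r) (p := -(n + 1)) (Or.inl hr.ne')).mul h1
  refine (h2.const_mul (-(A * b))).congr_deriv ?_
  have e : r ^ (b - 2) = r ^ (-(n + 1)) * ((r ^ b) ^ ν * r ^ (b - 1)) := by
    rw [← Real.rpow_mul hr.le, ← Real.rpow_add hr, ← Real.rpow_add hr, ← hn]
    congr 1; ring
  rw [e, Real.rpow_sub_one hr.ne' (-(n + 1))]
  simp only [Function.comp]
  ring

lemma regularProfile (h : ∀ ρ, IsPosSol ν s δ μ P Q ρ φ ψ M K) (hn : ν * b = n) (hb : 0 < b)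
    (A : ℝ) : RegularProfile fun r => A * φ (r ^ b) := by
  constructor
  · apply contDiffOn_two_of_hasDerivAt isOpen_Ioi
      (fun r hr => hasDerivAt_profile h hn A hr)
      (fun r hr => hasDerivAt_profile_deriv h hn A hr)
    intro r hr
    have hr0 : 0 < r := hr
    have hb0 := Real.rpow_pos_of_pos hr0 b
    have cb : ∀ p : ℝ, ContinuousAt (fun r : ℝ => r ^ p) r := fun p =>
      Real.continuousAt_rpow_const _ _ (Or.inl hr0.ne')
    have hφ : ContinuousAt (fun r => φ (r ^ b)) r := ContinuousAt.comp (f := fun r : ℝ => r ^ b)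
      ((h _).hasDerivAt_φ _ ⟨hb0, le_rfl⟩).continuousAt (cb b)
    have hψ : ContinuousAt (fun r => ψ (r ^ b)) r := ContinuousAt.comp (f := fun r : ℝ => r ^ b)
      ((h _).hasDerivAt_ψ _ ⟨hb0, le_rfl⟩).continuousAt (cb b)
    have hM : ContinuousAt (fun r => M (r ^ b)) r := ContinuousAt.comp (f := fun r : ℝ => r ^ b)
      ((h _).hasDerivAt_M _ ⟨hb0, le_rfl⟩).continuousAt (cb b)
    have hφ0 := (h _).φ_pos _ ⟨hb0.le, le_rfl⟩
    have hψ0 := (h _).ψ_pos _ ⟨hb0.le, le_rfl⟩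
    have hφs := hφ.rpow_const (p := s) (Or.inl hφ0.ne')
    have hψδ := hψ.rpow_const (p := δ) (Or.inl hψ0.ne')
    apply ContinuousAt.continuousWithinAt
    exact (((continuousAt_const.div continuousAt_id hr0.ne').mul
      (continuousAt_const.mul ((cb _).mul hM))).neg).sub
      ((cb _).mul (continuousAt_const.mul (hφs.mul hψδ)))
  · exact continuousOn_const.mul ((continuousOn_Ici h).comp
      (Real.continuous_rpow_const hb.le).continuousOn fun r hr => Real.rpow_nonneg hr b)

end IsPosSol

/-- The amplitudes are found from a linear system for their logarithms, whose determinant is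
`(s - 1)² - δμ`. -/
lemma exists_amplitudes {s δ μ p q : ℝ} (hD : (s - 1) ^ 2 - δ * μ ≠ 0) (hp : 0 < p)
    (hq : 0 < q) : ∃ A > 0, ∃ B > 0, A * p = A ^ s * B ^ δ ∧ B * q = A ^ μ * B ^ s := by
  set d := (s - 1) ^ 2 - δ * μ with hd
  set x := ((s - 1) * Real.log p - δ * Real.log q) / d with hx
  set y := ((s - 1) * Real.log q - μ * Real.log p) / d with hy
  refine ⟨Real.exp x, Real.exp_pos _, Real.exp y, Real.exp_pos _, ?_, ?_⟩
  · rw [← Real.exp_mul, ← Real.exp_mul, ← Real.exp_add]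
    rw [show Real.exp x * p = Real.exp (x + Real.log p) by rw [Real.exp_add, Real.exp_log hp]]
    congr 1
    rw [hx, hy]
    field_simp
    rw [hd]
    ring
  · rw [← Real.exp_mul, ← Real.exp_mul, ← Real.exp_add]
    rw [show Real.exp y * q = Real.exp (y + Real.log q) by rw [Real.exp_add, Real.exp_log hq]]
    congr 1
    rw [hx, hy]
    field_simp
    rw [hd]
    ring

theorem theorem1p3 (N : ℕ) (hN : 2 < N) (a s : ℝ) (ha : -2 < a) (hs : 0 < s) :
    (∀ δ μ : ℝ, 0 < δ → 0 < μ → OnCurve N a s δ μ → UnderHyperbola N a δ μ) ∧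
    (∀ δ μ : ℝ, 0 < δ → 0 < μ → 0 < δ * μ - (1 - s) ^ 2 → AboveCurve N a s δ μ →
      ∃ U V : ℝ → ℝ, IsGroundState N a s δ μ U V) := by
  have hN' : (2 : ℝ) < N := by exact_mod_cast hN
  have hn0 : 0 < (N : ℝ) - 2 := by linarith
  constructor
  · intro δ μ hδ hμ h
    have : 0 < min (1 / (μ + 1)) (1 / (δ + 1)) := lt_min (by positivity) (by positivity)
    have h2 : 0 < ((N : ℝ) - 2) * s / 2 * min (1 / (μ + 1)) (1 / (δ + 1)) := by positivity
    rw [OnCurve, curveRHS] at h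
    rw [UnderHyperbola, h]
    linarith
  · intro δ μ hδ hμ hD h
    set b := a + 2 with hb
    have hb0 : 0 < b := by linarith
    set ν := ((N : ℝ) - 2) / b with hν
    have hν0 : 0 < ν := by positivity
    have hνb : ν * b = (N : ℝ) - 2 := by rw [hν]; field_simp
    have habove : (ν + 1) / (μ + 1) + (ν + 1) / (δ + 1) <
        ν + ν * s / 2 * min (1 / (μ + 1)) (1 / (δ + 1)) := by
      rw [AboveCurve, curveLHS, curveRHS, ← hνb,
        show (N : ℝ) + a = (ν + 1) * b by linear_combination -hνb] at h
      apply lt_of_mul_lt_mul_right _ hb0.le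
      calc _ = (ν + 1) * b / (μ + 1) + (ν + 1) * b / (δ + 1) := by ring
        _ < _ := h
        _ = _ := by ring
    obtain ⟨t, ht, hpos⟩ := exists_staysPositive hν0 hs hδ hμ habove
    obtain ⟨φ, ψ, M, K, hsol⟩ :=
      hpos.exists_isPosSol hν0 hs hδ hμ ⟨ht.1.le, ht.2.le⟩
    have ht0 := ht.1
    have ht1 : 0 < 1 - t := by linarith [ht.2]
    obtain ⟨A, hA, B, hB, hAB, hBA⟩ := exists_amplitudes (s := s) (δ := δ) (μ := μ)
      (p := b ^ 2 * (1 - t)) (q := b ^ 2 * t) (by nlinarith) (by positivity) (by positivity)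
    have hsw := fun ρ => (hsol ρ).swap
    have hφ : ∀ r : ℝ, 0 < r → 0 < φ (r ^ b) := fun r hr =>
      (hsol _).φ_pos _ ⟨(Real.rpow_pos_of_pos hr b).le, le_rfl⟩
    have hψ : ∀ r : ℝ, 0 < r → 0 < ψ (r ^ b) := fun r hr =>
      (hsol _).ψ_pos _ ⟨(Real.rpow_pos_of_pos hr b).le, le_rfl⟩
    refine ⟨fun r => A * φ (r ^ b), fun r => B * ψ (r ^ b),
      IsPosSol.regularProfile hsol hνb hb0 A, IsPosSol.regularProfile hsw hνb hb0 B,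
      fun r hr => mul_pos hA (hφ r hr), fun r hr => mul_pos hB (hψ r hr), ?_, ?_⟩
    · intro x hx
      have hx0 := norm_pos_iff.2 hx
      rw [laplacian_radialLift hx (fun r hr => IsPosSol.hasDerivAt_profile hsol hνb A hr)
        (IsPosSol.hasDerivAt_profile_deriv hsol hνb A hx0)]
      simp only [radialLift]
      rw [Real.mul_rpow hA.le (hφ _ hx0).le, Real.mul_rpow hB.le (hψ _ hx0).le, hAB, hb]
      ring_nf
    · intro x hx
      have hx0 := norm_pos_iff.2 hx
      rw [laplacian_radialLift hx (fun r hr => IsPosSol.hasDerivAt_profile hsw hνb B hr)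
        (IsPosSol.hasDerivAt_profile_deriv hsw hνb B hx0)]
      simp only [radialLift]
      rw [Real.mul_rpow hA.le (hφ _ hx0).le, Real.mul_rpow hB.le (hψ _ hx0).le, hBA, hb]
      ring_nf
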